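/- Work in the hyperbolic plane of curvature $-1$. A regular $n$-gon is a (non-degenerate) convex geodesic $n$-gon all of whose sides have the same length and all of whose interior angles are equal; $\mathrm{area}$ and $\mathrm{perim}$ denote hyperbolic area and perimeter. Let $n\ge 3$. For $x\in\left(0,\frac{(n-2)\pi}{n}\right)$ put $$g_n(x)=\cosh^{-1}\left(\frac{\cos(\pi/n)}{\sin(x/2)}\right),\qquad \phi_n(x)=2g_n\left(\frac x2+\frac\pi2-\frac\pi n\right)-g_n(x).$$ Then $\phi_n$ has exactly one root $\Theta=\Theta(n)$ in $\left(0,\frac{(n-2)\pi}{n}\right)$, and for every regular hyperbolic $n$-gon $P$ with interior angle $\theta$ the following hold. 1. If $\theta\ge\Theta$, then for any two regular hyperbolic $n$-gons $P_1,P_2$ with $\mathrm{area}(P_1)+\mathrm{area}(P_2)=\mathrm{area}(P)$ we have $$\mathrm{perim}(P)\le \mathrm{perim}(P_1)+\mathrm{perim}(P_2),$$ and the inequality is strict if $\theta>\Theta$. 2. If $\theta<\Theta$, then there exist two disjoint regular hyperbolic $n$-gons $Q_1,Q_2$ with $\mathrm{area}(Q_1)+\mathrm{area}(Q_2)=\mathrm{area}(P)$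 and $$\mathrm{perim}(Q_1)+\mathrm{perim}(Q_2)<\mathrm{perim}(P).$$ -/

import Mathlib

/-! Convex geodesic polygons in the hyperbolic plane.  The hyperbolic plane is Mathlib's upper
half-plane, with its hyperbolic distance `dist` (curvature `-1`) and its invariant area measure
`volume` (`dx dy / y ^ 2`). -/

noncomputable section

namespace HyperbolicPlane

/-- The disc coordinate `(z - b) / (z - conj b)` of `z`, centred at `b`.  As a function of `z` this
is a holomorphic (hence conformal and orientation preserving) isometry from the upper half-plane
onto the Poincaré disc that sends `b` to `0`; the geodesics through `b` become the diameters of the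
disc.  So `direction b z` is, as a vector, a positive multiple of the initial velocity at `b`
(read in this coordinate) of the geodesic from `b` to `z`, and it is `0` iff `z = b`. -/
def direction (b z : UpperHalfPlane) : ℂ :=
  ((z : ℂ) - (b : ℂ)) / ((z : ℂ) - (starRingEnd ℂ) (b : ℂ))

/-- The angle `∠ a b c ∈ [0, π]` at `b` between the geodesics from `b` to `a` and from `b`
to `c`. -/
def angle (a b c : UpperHalfPlane) : ℝ :=
  InnerProductGeometry.angle (direction b a) (direction b c)

/-- A real number that is positive, zero or negative according as `z` lies strictly to the left of,
on, or strictly to the right of the complete geodesic that runs from `a` through `b` (for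
`a ≠ b`). -/
def side (a b z : UpperHalfPlane) : ℝ :=
  ((starRingEnd ℂ) (direction a b) * direction a z).im

/-- A (non-degenerate) convex geodesic `n`-gon, `n ≥ 3`, given by its vertices in counterclockwise
order: for each side, from a vertex to its cyclic successor `finRotate n i`, all the other vertices
lie strictly to the left of the geodesic through that side. -/
structure ConvexPolygon (n : ℕ) where
  vertex : Fin n → UpperHalfPlane
  three_le : 3 ≤ n
  convex : ∀ i j : Fin n, j ≠ i → j ≠ finRotate n i →
    0 < side (vertex i) (vertex (finRotate n i)) (vertex j)

namespace ConvexPolygon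

variable {n : ℕ} (P : ConvexPolygon n)

/-- The length of the side from the `i`-th vertex to the next one. -/
def sideLength (i : Fin n) : ℝ :=
  dist (P.vertex i) (P.vertex (finRotate n i))

/-- The interior angle at the `i`-th vertex. -/
def interiorAngle (i : Fin n) : ℝ :=
  angle (P.vertex ((finRotate n).symm i)) (P.vertex i) (P.vertex (finRotate n i))

/-- The closed region bounded by the polygon: the intersection of the closed half-planes to the
left of its sides. -/
def region : Set UpperHalfPlane :=
  {z | ∀ i : Fin n, 0 ≤ side (P.vertex i) (P.vertex (finRotate n i)) z}

/-- The hyperbolic area of the polygon. -/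
def area : ENNReal :=
  MeasureTheory.volume P.region

/-- The hyperbolic perimeter of the polygon. -/
def perim : ℝ :=
  ∑ i : Fin n, P.sideLength i

/-- A polygon is regular with interior angle `θ` if all its sides have the same length and all its
interior angles are equal to `θ`. -/
def IsRegularWithAngle (θ : ℝ) : Prop :=
  (∀ i j : Fin n, P.sideLength i = P.sideLength j) ∧ ∀ i : Fin n, P.interiorAngle i = θ

/-- A polygon is regular if all its sides have the same length and all its interior angles are
equal. -/
def IsRegular : Prop :=
  ∃ θ : ℝ, P.IsRegularWithAngle θ

end ConvexPolygon

/-- `g n x = arcosh (cos (π / n) / sin (x / 2))`, for `0 < x < (n - 2) π / n`. -/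
def g (n : ℕ) (x : ℝ) : ℝ :=
  Real.arcosh (Real.cos (Real.pi / n) / Real.sin (x / 2))

/-- `φ n x = 2 g n (x / 2 + π / 2 - π / n) - g n x`, for `0 < x < (n - 2) π / n`. -/
def phi (n : ℕ) (x : ℝ) : ℝ :=
  2 * g n (x / 2 + Real.pi / 2 - Real.pi / n) - g n x

end HyperbolicPlane

end

/-! The argument has a geometric and an analytic part.

Geometry.  In the hyperboloid model distances are Minkowski products (`cosh_dist_eq`), the side of a
geodesic on which a point lies is the sign of a determinant (`side_eq`), and angles are given by the
law of cosines (`cos_angle`).  For a polygon with equal sides and equal angles, four consecutive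
vertices therefore satisfy a linear recurrence with constant coefficients (`recurrence`), so that
the whole Gram matrix of the vertices is invariant under the cyclic shift.  Hence the vertices have
the same distance from their centroid, and the convexity of the polygon forces them to be equally
spaced and to wind around it exactly once (`ConvexPolygon.exists_isCentered`).  Trigonometry then
gives the side length `2 * g n θ`, and integration in polar coordinates about the centre, with the
area form `dX dY / Z` of the hyperboloid, gives the area `(n - 2) π - n θ`
(`ConvexPolygon.area_eq`).  Conversely there are regular polygons with any angle
`θ ∈ (0, (n - 2) π / n)` and any centre, and two of them with distant centres are disjoint.

Analysis.  Put `D = π / 2 - π / n`.  The condition on the areas says that the half angles `u`, `v`,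
`p` of `P₁`, `P₂`, `P` satisfy `u + v = p + D`.  With `halfSide D u = g n (2 * u)`, the rates of
decrease of `halfSide D` at `u` and at `v > u` compare as `cos u * cos v` compares with `cos D`, and
`cos u * cos v = (cos (p + D) + cos (v - u)) / 2` is monotone in `v - u`.  So, as `u` runs from `p`
to `(p + D) / 2`, the sum of the half sides increases and then decreases, and its minimum is
attained at an end: either the degenerate pair `(p, D)`, with the perimeter of `P`, or two congruent
polygons (`halfSide_add_dichotomy`).  The difference of these two values is the function `phi`, and
the same comparison of derivatives shows that `phi` increases from `-∞` and then decreases to `0`,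
so that it has exactly one zero, where it changes from negative to positive (`exists_threshold`). -/

noncomputable section

namespace HyperbolicPlane

open UpperHalfPlane MeasureTheory

/-! ### The hyperboloid model -/

/-- First coordinate of `z` in the hyperboloid model `Z ^ 2 = 1 + X ^ 2 + Y ^ 2`, `0 < Z`, of the
hyperbolic plane, with the apex `(0, 0, 1)` of the hyperboloid at the point `c`. -/
def hX (c z : ℍ) : ℝ :=
  (z.re - c.re) / z.im

/-- Second coordinate of `z` in the hyperboloid model with apex `c`. -/
def hY (c z : ℍ) : ℝ :=
  ((z.re - c.re) ^ 2 + z.im ^ 2 - c.im ^ 2) / (2 * z.im * c.im)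

/-- Third (timelike) coordinate of `z` in the hyperboloid model with apex `c`; it is the hyperbolic
cosine of the distance to `c`. -/
def hZ (c z : ℍ) : ℝ :=
  ((z.re - c.re) ^ 2 + z.im ^ 2 + c.im ^ 2) / (2 * z.im * c.im)

/-- The determinant of the matrix with rows `(x₁, y₁, z₁)`, `(x₂, y₂, z₂)`, `(x₃, y₃, z₃)`. -/
def tripleDet (x₁ y₁ z₁ x₂ y₂ z₂ x₃ y₃ z₃ : ℝ) : ℝ :=
  x₁ * (y₂ * z₃ - z₂ * y₃) - y₁ * (x₂ * z₃ - z₂ * x₃) + z₁ * (x₂ * y₃ - y₂ * x₃)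

/-- The determinant of the hyperboloid coordinates of three points. -/
def hDet (c p q r : ℍ) : ℝ :=
  tripleDet (hX c p) (hY c p) (hZ c p) (hX c q) (hY c q) (hZ c q) (hX c r) (hY c r) (hZ c r)

lemma hZ_pos (c z : ℍ) : 0 < hZ c z := by
  have := z.im_pos; have := c.im_pos
  unfold hZ; positivity

lemma hZ_sq (c z : ℍ) : hZ c z ^ 2 = 1 + hX c z ^ 2 + hY c z ^ 2 := by
  have := z.im_pos.ne'; have := c.im_pos.ne'
  unfold hZ hX hY; field_simp; ring

lemma hZ_eq (c z : ℍ) : hZ c z = √(1 + hX c z ^ 2 + hY c z ^ 2) := by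
  rw [← hZ_sq, Real.sqrt_sq (hZ_pos c z).le]

/-- The hyperbolic cosine of the distance is minus the Minkowski product. -/
lemma cosh_dist_eq (c a b : ℍ) :
    Real.cosh (dist a b) = hZ c a * hZ c b - hX c a * hX c b - hY c a * hY c b := by
  have := a.im_pos.ne'; have := c.im_pos.ne'; have := b.im_pos.ne'
  rw [cosh_dist']
  unfold hZ hX hY; field_simp; ring

lemma direction_eq (b z : ℍ) :
    direction b z =
      ⟨((z.re - b.re) ^ 2 + z.im ^ 2 - b.im ^ 2) / ((z.re - b.re) ^ 2 + (z.im + b.im) ^ 2),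
      - 2 * b.im * (z.re - b.re) / ((z.re - b.re) ^ 2 + (z.im + b.im) ^ 2)⟩ := by
  have h1 := b.im_pos
  have h2 := z.im_pos
  have h : (z.re - b.re) ^ 2 + (z.im + b.im) ^ 2 ≠ 0 := by positivity
  have h' : ((z : ℂ) - (starRingEnd ℂ) (b : ℂ)) ≠ 0 := by
    intro hh
    have := congrArg Complex.im hh
    simp at this
    linarith
  unfold direction
  rw [div_eq_iff h']
  apply Complex.ext
  · simp
    field_simp
    ring
  · simp
    field_simp
    ring

lemma one_add_cosh_dist (a b : ℍ) :
    1 + Real.cosh (dist a b) = ((b.re - a.re) ^ 2 + (b.im + a.im) ^ 2) / (2 * a.im * b.im) := by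
  have := a.im_pos.ne'; have := b.im_pos.ne'
  rw [cosh_dist']; field_simp; ring

/-- A geodesic is the section of the hyperboloid by a plane through the origin, so the side of a
point is the sign of a determinant. -/
lemma side_eq (c a b z : ℍ) :
    side a b z = hDet c a b z / ((1 + Real.cosh (dist a b)) * (1 + Real.cosh (dist a z))) := by
  have h1 := a.im_pos
  have h2 := b.im_pos
  have h3 := z.im_pos
  have h4 := c.im_pos
  have h : (z.re - a.re) ^ 2 + (z.im + a.im) ^ 2 ≠ 0 := by positivity
  have h' : (b.re - a.re) ^ 2 + (b.im + a.im) ^ 2 ≠ 0 := by positivity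
  unfold side hDet tripleDet hX hY hZ
  rw [one_add_cosh_dist, one_add_cosh_dist, direction_eq, direction_eq]
  simp only [Complex.mul_im, Complex.conj_re, Complex.conj_im]
  field_simp
  ring

lemma one_add_cosh_pos (x : ℝ) : 0 < 1 + Real.cosh x := by
  have := Real.cosh_pos x
  positivity

lemma side_pos_iff (c a b z : ℍ) : 0 < side a b z ↔ 0 < hDet c a b z := by
  rw [side_eq c, div_pos_iff_of_pos_right (mul_pos (one_add_cosh_pos _) (one_add_cosh_pos _))]

lemma side_nonneg_iff (c a b z : ℍ) : 0 ≤ side a b z ↔ 0 ≤ hDet c a b z := by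
  rw [side_eq c, le_div_iff₀ (mul_pos (one_add_cosh_pos _) (one_add_cosh_pos _)), zero_mul]

lemma inner_direction (b a c : ℍ) :
    inner ℝ (direction b a) (direction b c) =
      (Real.cosh (dist a b) * Real.cosh (dist b c) - Real.cosh (dist a c)) /
        ((1 + Real.cosh (dist a b)) * (1 + Real.cosh (dist b c))) := by
  have h1 := a.im_pos
  have h2 := b.im_pos
  have h3 := c.im_pos
  have h : (b.re - a.re) ^ 2 + (b.im + a.im) ^ 2 ≠ 0 := by positivity
  have h' : (c.re - b.re) ^ 2 + (c.im + b.im) ^ 2 ≠ 0 := by positivity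
  have h'' : (a.re - b.re) ^ 2 + (a.im + b.im) ^ 2 ≠ 0 := by positivity
  rw [one_add_cosh_dist, one_add_cosh_dist, cosh_dist', cosh_dist', cosh_dist', direction_eq,
    direction_eq, Complex.inner]
  simp only [Complex.mul_re, Complex.conj_re, Complex.conj_im]
  rw [show (b.re - a.re) ^ 2 + (b.im + a.im) ^ 2 = (a.re - b.re) ^ 2 + (a.im + b.im) ^ 2 by ring]
  field_simp
  ring

lemma norm_direction (b a : ℍ) :
    ‖direction b a‖ = √(Real.cosh (dist a b) ^ 2 - 1) / (1 + Real.cosh (dist a b)) := by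
  have h := inner_direction b a a
  rw [real_inner_self_eq_norm_sq, dist_self, Real.cosh_zero, dist_comm b a] at h
  have h0 := one_add_cosh_pos (dist a b)
  rw [← Real.sqrt_sq (norm_nonneg (direction b a)), h, ← pow_two, ← pow_two,
    Real.sqrt_div' _ (sq_nonneg _), Real.sqrt_sq h0.le]

/-- The hyperbolic law of cosines. -/
lemma cos_angle (a b c : ℍ) :
    Real.cos (angle a b c) =
      (Real.cosh (dist a b) * Real.cosh (dist b c) - Real.cosh (dist a c)) /
        (√(Real.cosh (dist a b) ^ 2 - 1) * √(Real.cosh (dist b c) ^ 2 - 1)) := by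
  have h0 := one_add_cosh_pos (dist a b)
  have h1 := one_add_cosh_pos (dist b c)
  unfold angle
  rw [InnerProductGeometry.cos_angle, inner_direction, norm_direction, norm_direction,
    dist_comm c b, div_mul_div_comm, div_div_div_cancel_right₀ (mul_pos h0 h1).ne']

/-- The point with hyperboloid coordinates `x`, `y` and `√(1 + x ^ 2 + y ^ 2)` for the apex `c`. -/
def ofXY (c : ℍ) (x y : ℝ) : ℍ :=
  ⟨⟨c.re + c.im * x / (√(1 + x ^ 2 + y ^ 2) - y), c.im / (√(1 + x ^ 2 + y ^ 2) - y)⟩, by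
    have : y < √(1 + x ^ 2 + y ^ 2) := Real.lt_sqrt_of_sq_lt (by nlinarith [sq_nonneg x])
    exact div_pos c.im_pos (sub_pos.2 this)⟩

lemma sqrt_sub_pos (x y : ℝ) : 0 < √(1 + x ^ 2 + y ^ 2) - y :=
  sub_pos.2 (Real.lt_sqrt_of_sq_lt (by nlinarith [sq_nonneg x]))

lemma ofXY_re (c : ℍ) (x y : ℝ) :
    (ofXY c x y).re = c.re + c.im * x / (√(1 + x ^ 2 + y ^ 2) - y) := rfl
lemma ofXY_im (c : ℍ) (x y : ℝ) :
    (ofXY c x y).im = c.im / (√(1 + x ^ 2 + y ^ 2) - y) := rfl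

lemma hX_ofXY (c : ℍ) (x y : ℝ) : hX c (ofXY c x y) = x := by
  have h := sqrt_sub_pos x y
  have := c.im_pos
  unfold hX
  rw [ofXY_re, ofXY_im]
  field_simp
  ring

lemma hY_ofXY (c : ℍ) (x y : ℝ) : hY c (ofXY c x y) = y := by
  have h := sqrt_sub_pos x y
  have := c.im_pos
  have hs := Real.sq_sqrt (show 0 ≤ 1 + x ^ 2 + y ^ 2 by positivity)
  unfold hY
  rw [ofXY_re, ofXY_im]
  field_simp
  ring_nf
  linear_combination -c.im ^ 2 * hs

lemma ofXY_hX_hY (c z : ℍ) : ofXY c (hX c z) (hY c z) = z := by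
  have h1 := c.im_pos
  have h2 := z.im_pos
  have h : √(1 + hX c z ^ 2 + hY c z ^ 2) - hY c z = c.im / z.im := by
    rw [← hZ_eq]; unfold hZ hY; field_simp; ring
  apply UpperHalfPlane.ext_re_im
  · rw [ofXY_re, h]; unfold hX; field_simp; ring
  · rw [ofXY_im, h]; field_simp

/-! ### Linear algebra on the hyperboloid -/

/-- A vector that is Minkowski-orthogonal to two distinct points of the hyperboloid and lies in the
plane they span vanishes. -/
lemma eq_zero_of_orthogonal {b₁ b₂ b₃ c₁ c₂ c₃ e₁ e₂ e₃ a : ℝ}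
    (hb : b₃ ^ 2 = 1 + b₁ ^ 2 + b₂ ^ 2) (hc : c₃ ^ 2 = 1 + c₁ ^ 2 + c₂ ^ 2)
    (ha : b₃ * c₃ - b₁ * c₁ - b₂ * c₂ = a) (ha1 : 1 < a)
    (h₁ : b₃ * e₃ - b₁ * e₁ - b₂ * e₂ = 0) (h₂ : c₃ * e₃ - c₁ * e₁ - c₂ * e₂ = 0)
    (h₃ : tripleDet b₁ b₂ b₃ c₁ c₂ c₃ e₁ e₂ e₃ = 0) : e₁ = 0 ∧ e₂ = 0 ∧ e₃ = 0 := by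
  unfold tripleDet at h₃
  -- the Minkowski norm of the normal vector of the plane
  have key : (b₁ * c₂ - b₂ * c₁) ^ 2 - (b₂ * c₃ - b₃ * c₂) ^ 2 - (b₃ * c₁ - b₁ * c₃) ^ 2
      = 1 - a ^ 2 := by
    rw [← ha]
    linear_combination (-c₁ ^ 2 - c₂ ^ 2 + c₃ ^ 2) * hb + hc
  have hne : 1 - a ^ 2 ≠ 0 := by nlinarith
  -- Cramer's rule: the coefficients are cofactors
  refine ⟨?_, ?_, ?_⟩ <;> apply (mul_eq_zero.1 (?_ : (1 - a ^ 2) * _ = 0)).resolve_left hne <;>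
    rw [← key]
  · linear_combination (-c₂ * (b₁ * c₂ - b₂ * c₁) - c₃ * (b₃ * c₁ - b₁ * c₃)) * h₁
      + ((b₃ * c₁ - b₁ * c₃) * b₃ + (b₁ * c₂ - b₂ * c₁) * b₂) * h₂ - (b₂ * c₃ - b₃ * c₂) * h₃
  · linear_combination (c₃ * (b₂ * c₃ - b₃ * c₂) + c₁ * (b₁ * c₂ - b₂ * c₁)) * h₁
      + (-(b₁ * c₂ - b₂ * c₁) * b₁ - (b₂ * c₃ - b₃ * c₂) * b₃) * h₂ - (b₃ * c₁ - b₁ * c₃) * h₃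
  · linear_combination (-c₁ * (b₃ * c₁ - b₁ * c₃) + c₂ * (b₂ * c₃ - b₃ * c₂)) * h₁
      + (-(b₂ * c₃ - b₃ * c₂) * b₂ + (b₃ * c₁ - b₁ * c₃) * b₁) * h₂ + (b₁ * c₂ - b₂ * c₁) * h₃

/-- The Gram determinant of three points of the hyperboloid. -/
lemma hDet_sq (c p q r : ℍ) :
    hDet c p q r ^ 2 = 1 + 2 * Real.cosh (dist p q) * Real.cosh (dist q r) * Real.cosh (dist p r)
      - Real.cosh (dist p q) ^ 2 - Real.cosh (dist q r) ^ 2 - Real.cosh (dist p r) ^ 2 := by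
  have hp := hZ_sq c p
  have hq := hZ_sq c q
  have hr := hZ_sq c r
  rw [cosh_dist_eq c p q, cosh_dist_eq c q r, cosh_dist_eq c p r]
  unfold hDet tripleDet
  generalize hX c p = p₁ at *
  generalize hY c p = p₂ at *
  generalize hZ c p = p₃ at *
  generalize hX c q = q₁ at *
  generalize hY c q = q₂ at *
  generalize hZ c q = q₃ at *
  generalize hX c r = r₁ at *
  generalize hY c r = r₂ at *
  generalize hZ c r = r₃ at *
  have h1 : (p₁ * (q₂ * r₃ - q₃ * r₂) - p₂ * (q₁ * r₃ - q₃ * r₁) + p₃ * (q₁ * r₂ - q₂ * r₁)) ^ 2 =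
      (p₃ ^ 2 - p₁ ^ 2 - p₂ ^ 2) * (q₃ ^ 2 - q₁ ^ 2 - q₂ ^ 2) * (r₃ ^ 2 - r₁ ^ 2 - r₂ ^ 2)
      + 2 * (p₃ * q₃ - p₁ * q₁ - p₂ * q₂) * (q₃ * r₃ - q₁ * r₁ - q₂ * r₂) *
        (p₃ * r₃ - p₁ * r₁ - p₂ * r₂)
      - (r₃ ^ 2 - r₁ ^ 2 - r₂ ^ 2) * (p₃ * q₃ - p₁ * q₁ - p₂ * q₂) ^ 2
      - (p₃ ^ 2 - p₁ ^ 2 - p₂ ^ 2) * (q₃ * r₃ - q₁ * r₁ - q₂ * r₂) ^ 2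
      - (q₃ ^ 2 - q₁ ^ 2 - q₂ ^ 2) * (p₃ * r₃ - p₁ * r₁ - p₂ * r₂) ^ 2 := by ring
  rw [h1, show p₃ ^ 2 - p₁ ^ 2 - p₂ ^ 2 = 1 by linarith,
    show q₃ ^ 2 - q₁ ^ 2 - q₂ ^ 2 = 1 by linarith,
    show r₃ ^ 2 - r₁ ^ 2 - r₂ ^ 2 = 1 by linarith]
  ring

/-- Four consecutive points on the hyperboloid with equal successive distances, equal distances
between next-but-one points, and equal orientations satisfy a palindromic linear recurrence whose
coefficient depends on the two distances only: `s - p` and `r - q` are both orthogonal to `q + r`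
and to the normal of the plane spanned by `q` and `r`. -/
lemma recurrence (c p q r s : ℍ) {a b : ℝ} (ha : 1 < a)
    (hpq : Real.cosh (dist p q) = a) (hqr : Real.cosh (dist q r) = a)
    (hrs : Real.cosh (dist r s) = a) (hpr : Real.cosh (dist p r) = b)
    (hqs : Real.cosh (dist q s) = b) (h₁ : 0 < hDet c p q r) (h₂ : 0 < hDet c q r s) :
    hX c s = hX c p + (b - a) / (a - 1) * (hX c r - hX c q) ∧
    hY c s = hY c p + (b - a) / (a - 1) * (hY c r - hY c q) ∧
    hZ c s = hZ c p + (b - a) / (a - 1) * (hZ c r - hZ c q) := by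
  have hdet : hDet c p q r = hDet c q r s := by
    have := hDet_sq c p q r
    have h' := hDet_sq c q r s
    rw [hpq, hqr, hpr] at this
    rw [hqr, hrs, hqs] at h'
    exact (sq_eq_sq₀ h₁.le h₂.le).1 (this.trans h'.symm)
  have hne : a - 1 ≠ 0 := by linarith
  rw [cosh_dist_eq c] at hpq hqr hrs hpr hqs
  have hq := hZ_sq c q
  have hr := hZ_sq c r
  unfold hDet tripleDet at hdet
  obtain ⟨k, hk⟩ : ∃ k, k = (b - a) / (a - 1) := ⟨_, rfl⟩
  have hk' : k * (a - 1) = b - a := by rw [hk]; field_simp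
  rw [← hk]
  obtain ⟨h1, h2, h3⟩ := eq_zero_of_orthogonal hq hr hqr ha
    (e₁ := hX c s - (hX c p + k * (hX c r - hX c q)))
    (e₂ := hY c s - (hY c p + k * (hY c r - hY c q)))
    (e₃ := hZ c s - (hZ c p + k * (hZ c r - hZ c q)))
    (by linear_combination hqs - hpq - k * hqr + k * hq - hk')
    (by linear_combination hrs - hpr + k * hqr - k * hr + hk')
    (by unfold tripleDet; linear_combination -hdet)
  exact ⟨sub_eq_zero.1 h1, sub_eq_zero.1 h2, sub_eq_zero.1 h3⟩

/-- Finitely many points have a centroid: a point `c` such that the sum of the hyperboloid vectors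
is a multiple of the apex vector of `c`. -/
lemma exists_center {ι : Type*} [Fintype ι] [Nonempty ι] (v : ι → ℍ) :
    ∃ c : ℍ, ∑ i, hX c (v i) = 0 ∧ ∑ i, hY c (v i) = 0 := by
  have hs : 0 < ∑ i, 1 / (v i).im :=
    Finset.sum_pos (fun i _ => one_div_pos.2 (v i).im_pos) Finset.univ_nonempty
  obtain ⟨x, hx⟩ : ∃ x, x = (∑ i, (v i).re / (v i).im) / ∑ i, 1 / (v i).im := ⟨_, rfl⟩
  -- `x` and `t` are the real part and the squared imaginary part of the centroid
  have hs' : 0 < ∑ i, (((v i).re - x) ^ 2 + (v i).im ^ 2) / (v i).im := by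
    refine Finset.sum_pos (fun i _ => ?_) Finset.univ_nonempty
    have := (v i).im_pos
    positivity
  obtain ⟨t, ht⟩ : ∃ t, t = (∑ i, (((v i).re - x) ^ 2 + (v i).im ^ 2) / (v i).im) /
    ∑ i, 1 / (v i).im := ⟨_, rfl⟩
  have ht0 : 0 < t := by rw [ht]; exact div_pos hs' hs
  refine ⟨⟨⟨x, √t⟩, Real.sqrt_pos.2 ht0⟩, ?_, ?_⟩
  · have : ∀ i, hX ⟨⟨x, √t⟩, Real.sqrt_pos.2 ht0⟩ (v i) =
        (v i).re / (v i).im - x * (1 / (v i).im) := by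
      intro i
      change ((v i).re - x) / (v i).im = _
      ring
    simp_rw [this]
    rw [Finset.sum_sub_distrib, ← Finset.mul_sum, sub_eq_zero, hx]
    field_simp
  · have : ∀ i, hY ⟨⟨x, √t⟩, Real.sqrt_pos.2 ht0⟩ (v i) =
        ((((v i).re - x) ^ 2 + (v i).im ^ 2) / (v i).im - t * (1 / (v i).im)) / (2 * √t) := by
      intro i
      have := (v i).im_pos
      have h2 := Real.sqrt_pos.2 ht0
      change (((v i).re - x) ^ 2 + (v i).im ^ 2 - √t ^ 2) / (2 * (v i).im * √t) = _
      rw [Real.sq_sqrt ht0.le]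
      field_simp
    simp_rw [this]
    rw [← Finset.sum_div, Finset.sum_sub_distrib, ← Finset.mul_sum]
    have : (∑ i, (((v i).re - x) ^ 2 + (v i).im ^ 2) / (v i).im) - t * ∑ i, 1 / (v i).im = 0 := by
      rw [sub_eq_zero, ht]; field_simp
    rw [this, zero_div]

/-! ### Distances between the vertices of a regular polygon -/

lemma val_finRotate_pow {n : ℕ} (d : ℕ) (i : Fin n) :
    (((finRotate n) ^ d) i : ℕ) = (i + d) % n := by
  have hn : 0 < n := i.pos
  obtain ⟨m, rfl⟩ : ∃ m, n = m + 1 := ⟨n - 1, by omega⟩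
  induction d with
  | zero => simp [Nat.mod_eq_of_lt i.isLt]
  | succ d ih =>
    rw [pow_succ', Equiv.Perm.mul_apply, finRotate_apply, Fin.val_add, ih, Fin.val_one',
      Nat.mod_add_mod, Nat.add_mod_mod, add_assoc]

lemma val_finRotate {n : ℕ} (i : Fin n) : (finRotate n i : ℕ) = (i + 1) % n := by
  simpa using val_finRotate_pow 1 i

lemma exists_finRotate_pow_eq {n : ℕ} (i j : Fin n) : ∃ d : ℕ, ((finRotate n) ^ d) i = j := by
  refine ⟨n - i + j, Fin.ext ?_⟩
  rw [val_finRotate_pow]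
  have := i.isLt
  rw [show (i : ℕ) + (n - i + j) = j + n by omega, Nat.add_mod_right, Nat.mod_eq_of_lt j.isLt]

lemma finRotate_ne {n : ℕ} (hn : 3 ≤ n) (i : Fin n) :
    finRotate n i ≠ i ∧ finRotate n (finRotate n i) ≠ i := by
  have h1 := i.isLt
  constructor <;> intro h
  · have := congrArg Fin.val h
    rw [val_finRotate] at this
    by_cases h2 : (i : ℕ) + 1 < n
    · rw [Nat.mod_eq_of_lt h2] at this; omega
    · rw [show (i : ℕ) + 1 = n by omega, Nat.mod_self] at this; omega
  · have := congrArg Fin.val h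
    have h3 := val_finRotate_pow 2 i
    rw [pow_two, Equiv.Perm.mul_apply, this] at h3
    by_cases h2 : (i : ℕ) + 2 < n
    · rw [Nat.mod_eq_of_lt h2] at h3; omega
    · rw [Nat.mod_eq_sub_mod (by omega), Nat.mod_eq_of_lt (by omega)] at h3; omega

lemma hDet_self_right (c p q : ℍ) : hDet c p q q = 0 := by
  unfold hDet tripleDet; ring

lemma hDet_self_left (c p q : ℍ) : hDet c p q p = 0 := by
  unfold hDet tripleDet; ring

lemma hDet_self (c p q : ℍ) : hDet c p p q = 0 := by
  unfold hDet tripleDet; ring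

namespace ConvexPolygon

variable {n : ℕ} (P : ConvexPolygon n)

lemma hDet_pos (c : ℍ) {i j : Fin n} (h : j ≠ i) (h' : j ≠ finRotate n i) :
    0 < hDet c (P.vertex i) (P.vertex (finRotate n i)) (P.vertex j) :=
  (side_pos_iff c _ _ _).1 (P.convex i j h h')

lemma hDet_consecutive_pos (c : ℍ) (i : Fin n) :
    0 < hDet c (P.vertex i) (P.vertex (finRotate n i))
      (P.vertex (finRotate n (finRotate n i))) :=
  P.hDet_pos c (finRotate_ne P.three_le i).2 (finRotate_ne P.three_le _).1

lemma one_lt_cosh_dist (i : Fin n) :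
    1 < Real.cosh (dist (P.vertex i) (P.vertex (finRotate n i))) := by
  rw [Real.one_lt_cosh, dist_ne_zero]
  intro h
  have := P.hDet_consecutive_pos UpperHalfPlane.I i
  rw [h, hDet_self] at this
  exact lt_irrefl _ this

/-- Side, angle, side: the length of a short diagonal of an equilateral polygon. -/
lemma cosh_dist_eq_of_angle {θ a : ℝ} {i : Fin n} (hθ : P.interiorAngle (finRotate n i) = θ)
    (h₁ : Real.cosh (P.sideLength i) = a) (h₂ : Real.cosh (P.sideLength (finRotate n i)) = a) :
    Real.cosh (dist (P.vertex i) (P.vertex (finRotate n (finRotate n i)))) =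
      a ^ 2 - (a ^ 2 - 1) * Real.cos θ := by
  have ha := P.one_lt_cosh_dist i
  unfold sideLength at h₁ h₂
  rw [h₁] at ha
  unfold interiorAngle at hθ
  rw [Equiv.symm_apply_apply] at hθ
  have h := cos_angle (P.vertex i) (P.vertex (finRotate n i))
    (P.vertex (finRotate n (finRotate n i)))
  have h0 : 0 < a ^ 2 - 1 := by nlinarith
  rw [hθ, h₁, h₂, Real.mul_self_sqrt h0.le, eq_div_iff h0.ne'] at h
  linarith

/-- In a regular polygon all the distances between vertices, not only those between neighbours, are
invariant under the cyclic shift of the vertices. -/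
lemma cosh_dist_finRotate {θ : ℝ} (hP : P.IsRegularWithAngle θ) (i j : Fin n) :
    Real.cosh (dist (P.vertex (finRotate n i)) (P.vertex (finRotate n j))) =
      Real.cosh (dist (P.vertex i) (P.vertex j)) := by
  set a := Real.cosh (P.sideLength i) with ha
  have hside : ∀ k, Real.cosh (dist (P.vertex k) (P.vertex (finRotate n k))) = a := fun k => by
    rw [ha, hP.1 i k]; rfl
  have hdiag : ∀ k, Real.cosh (dist (P.vertex k) (P.vertex (finRotate n (finRotate n k)))) =
      a ^ 2 - (a ^ 2 - 1) * Real.cos θ := fun k =>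
    P.cosh_dist_eq_of_angle (hP.2 _) (hside k) (hside _)
  have ha1 : 1 < a := P.one_lt_cosh_dist i
  have hrec := fun k => recurrence UpperHalfPlane.I _ _ _ _ ha1 (hside k) (hside _) (hside _)
    (hdiag k) (hdiag _) (P.hDet_consecutive_pos _ k) (P.hDet_consecutive_pos _ _)
  -- induction on the gap between the indices: the first three gaps are given, the recurrence does
  -- the rest
  have key : ∀ d : ℕ, ∀ k, Real.cosh (dist (P.vertex (finRotate n k))
      (P.vertex (((finRotate n) ^ d) (finRotate n k)))) =
      Real.cosh (dist (P.vertex k) (P.vertex (((finRotate n) ^ d) k))) := by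
    intro d
    induction d using Nat.strong_induction_on with
    | _ d ih =>
      intro k
      match d, ih with
      | 0, _ => simp
      | 1, _ => simp only [pow_one]; rw [hside, hside]
      | 2, _ => simp only [pow_two, Equiv.Perm.mul_apply]; rw [hdiag, hdiag]
      | d + 3, ih =>
        have e : ∀ l, ((finRotate n) ^ (d + 3)) l =
          finRotate n (finRotate n (finRotate n (((finRotate n) ^ d) l))) := fun l => by
          simp [pow_succ']
        have i0 := ih d (by omega) k
        have i1 := ih (d + 1) (by omega) k
        have i2 := ih (d + 2) (by omega) k
        simp only [pow_succ' _ (d + 1), pow_succ' _ d, Equiv.Perm.mul_apply] at i1 i2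
        rw [e, e]
        obtain ⟨x1, y1, z1⟩ := hrec (((finRotate n) ^ d) k)
        obtain ⟨x2, y2, z2⟩ := hrec (((finRotate n) ^ d) (finRotate n k))
        rw [cosh_dist_eq UpperHalfPlane.I] at i0 i1 i2 ⊢
        rw [cosh_dist_eq UpperHalfPlane.I] at i0 i1 i2 ⊢
        rw [x1, y1, z1, x2, y2, z2]
        generalize (a ^ 2 - (a ^ 2 - 1) * Real.cos θ - a) / (a - 1) = κ
        linear_combination i0 + κ * (i2 - i1)
  obtain ⟨d, rfl⟩ := exists_finRotate_pow_eq i j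
  have := key d i
  rwa [← Equiv.Perm.mul_apply, ← pow_succ, pow_succ', Equiv.Perm.mul_apply] at this

end ConvexPolygon

/-- The determinant that decides on which side of the chord from angle `α` to angle `α + 2 * η` of a
circle about the apex a point lies; `α + η` is the direction of the midpoint of the chord. -/
lemma circle_det (ρ h α η x y z : ℝ) :
    tripleDet (ρ * Real.cos α) (ρ * Real.sin α) h (ρ * Real.cos (α + 2 * η))
      (ρ * Real.sin (α + 2 * η)) h x y z =
    2 * ρ * Real.sin η * (ρ * Real.cos η * z -
      h * (x * Real.cos (α + η) + y * Real.sin (α + η))) := by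
  unfold tripleDet
  have h1 := Real.sin_sq_add_cos_sq α
  have h2 := Real.sin_sq_add_cos_sq η
  rw [Real.cos_add, Real.sin_add, Real.cos_add, Real.sin_add, Real.sin_two_mul, Real.cos_two_mul]
  generalize Real.sin α = s at *
  generalize Real.cos α = c at *
  generalize Real.sin η = t at *
  generalize Real.cos η = d at *
  linear_combination (2 * ρ ^ 2 * t * d * z) * h1 + (2 * h * ρ * (c * y - s * x)) * h2

lemma circle_det_vertex (ρ h α η γ : ℝ) :
    tripleDet (ρ * Real.cos α) (ρ * Real.sin α) h (ρ * Real.cos (α + 2 * η))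
      (ρ * Real.sin (α + 2 * η)) h (ρ * Real.cos γ) (ρ * Real.sin γ) h =
    4 * h * ρ ^ 2 * (Real.sin η * Real.sin ((γ - α) / 2) * Real.sin ((γ - α) / 2 - η)) := by
  rw [circle_det]
  have h1 : Real.cos γ * Real.cos (α + η) + Real.sin γ * Real.sin (α + η) =
      Real.cos (γ - (α + η)) := (Real.cos_sub _ _).symm
  have h2 := Real.cos_sub_cos η (γ - (α + η))
  rw [show (η + (γ - (α + η))) / 2 = (γ - α) / 2 by ring,
    show (η - (γ - (α + η))) / 2 = - ((γ - α) / 2 - η) by ring, Real.sin_neg] at h2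
  linear_combination 2 * ρ ^ 2 * Real.sin η * h * (h2 - h1)

/-! ### Regular polygons are inscribed in circles -/

/-- The points `v i` lie, in counterclockwise order and equally spaced, on the circle about `c`
whose hyperbolic radius has hyperbolic sine `ρ`, the first one in direction `φ`. -/
def IsCentered {n : ℕ} (c : ℍ) (ρ φ : ℝ) (v : Fin n → ℍ) : Prop :=
  ∀ i : Fin n, hX c (v i) = ρ * Real.cos (φ + i * (2 * (Real.pi / n))) ∧
    hY c (v i) = ρ * Real.sin (φ + i * (2 * (Real.pi / n)))

/-- If the chords of a regular (possibly star-shaped) polygon with half rotation angle `η` have all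
the other vertices on their left, the vertices wind around the centre only once. -/
lemma angle_lt_pi_of_sin_pos {n : ℕ} {η : ℝ} (h0 : 0 < η) (h1 : η < Real.pi)
    (h : ∀ d : ℕ, 2 ≤ d → d < n → 0 < Real.sin η * Real.sin (d * η) * Real.sin (d * η - η)) :
    ∀ d : ℕ, 1 ≤ d → d < n → d * η < Real.pi := by
  intro d hd
  induction d, hd using Nat.le_induction with
  | base => intro _; simpa using h1
  | succ d hd ih =>
    intro hdn
    have ih := ih (by omega)
    have := h (d + 1) (by omega) hdn
    have hd0 : (0 : ℝ) < d := by exact_mod_cast hd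
    push_cast at this ⊢
    rw [show ((d : ℝ) + 1) * η - η = d * η by ring] at this
    have s1 := Real.sin_pos_of_pos_of_lt_pi h0 h1
    have s2 := Real.sin_pos_of_pos_of_lt_pi (by positivity) ih
    have s3 := pos_of_mul_pos_right (pos_of_mul_pos_left this s2.le) s1.le
    by_contra hcon
    have : Real.sin ((d + 1) * η) ≤ 0 := by
      have := Real.sin_nonneg_of_nonneg_of_le_pi (x := ((d : ℝ) + 1) * η - Real.pi) (by linarith)
        (by linarith)
      rw [Real.sin_sub_pi] at this
      linarith
    linarith

/-- A regular convex polygon is inscribed in a circle, with equally spaced vertices.  The centre is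
the centroid of the vertices: by invariance of the distances under the shift, all the vertices have
the same distance from it, and the shift acts as a rotation. -/
lemma ConvexPolygon.exists_isCentered {n : ℕ} (P : ConvexPolygon n) {θ : ℝ}
    (hP : P.IsRegularWithAngle θ) :
    ∃ (c : ℍ) (ρ φ : ℝ), 0 < ρ ∧ IsCentered c ρ φ P.vertex := by
  have hn := P.three_le
  set i₀ : Fin n := ⟨0, by omega⟩ with hi₀
  have : Nonempty (Fin n) := ⟨i₀⟩
  obtain ⟨c, hcX, hcY⟩ := exists_center P.vertex
  -- the row sums of the Gram matrix are the heights over the centroid, and the Gram matrix is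
  -- invariant under the shift
  have hrow : ∀ i, ∑ j, Real.cosh (dist (P.vertex i) (P.vertex j)) =
      hZ c (P.vertex i) * ∑ j, hZ c (P.vertex j) := by
    intro i
    simp_rw [cosh_dist_eq c]
    rw [Finset.sum_sub_distrib, Finset.sum_sub_distrib, ← Finset.mul_sum, ← Finset.mul_sum,
      ← Finset.mul_sum, hcX, hcY]
    ring
  have hZsum : 0 < ∑ j, hZ c (P.vertex j) :=
    Finset.sum_pos (fun i _ => hZ_pos _ _) Finset.univ_nonempty
  have hstep : ∀ i, hZ c (P.vertex (finRotate n i)) = hZ c (P.vertex i) := by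
    intro i
    have := hrow (finRotate n i)
    rw [← Equiv.sum_comp (finRotate n)] at this
    simp_rw [P.cosh_dist_finRotate hP] at this
    rw [hrow i] at this
    exact (mul_right_cancel₀ hZsum.ne' this).symm
  set h := hZ c (P.vertex i₀) with hh
  have hpow : ∀ d : ℕ, hZ c (P.vertex (((finRotate n) ^ d) i₀)) = h := by
    intro d
    induction d with
    | zero => rfl
    | succ d ih => rw [pow_succ', Equiv.Perm.mul_apply, hstep, ih]
  have hheight : ∀ i, hZ c (P.vertex i) = h := fun i => by
    obtain ⟨d, rfl⟩ := exists_finRotate_pow_eq i₀ i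
    exact hpow d
  have hnorm : ∀ i, hX c (P.vertex i) ^ 2 + hY c (P.vertex i) ^ 2 = h ^ 2 - 1 := fun i => by
    have := hZ_sq c (P.vertex i)
    rw [hheight] at this
    linarith
  -- consecutive vertices subtend the same angle at the centre, up to its sign
  have hcons : ∀ i, hX c (P.vertex i) * hX c (P.vertex (finRotate n i)) +
      hY c (P.vertex i) * hY c (P.vertex (finRotate n i)) =
      h ^ 2 - Real.cosh (P.sideLength i₀) := fun i => by
    have := cosh_dist_eq c (P.vertex i) (P.vertex (finRotate n i))
    rw [hheight, hheight] at this
    rw [hP.1 i₀ i, ConvexPolygon.sideLength, this]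
    ring
  -- the angle is positive, because the centroid lies to the left of each side
  have hpos : ∀ i, 0 < hX c (P.vertex i) * hY c (P.vertex (finRotate n i)) -
      hY c (P.vertex i) * hX c (P.vertex (finRotate n i)) := by
    intro i
    have h1 : ∑ j, hDet c (P.vertex i) (P.vertex (finRotate n i)) (P.vertex j) =
        (hX c (P.vertex i) * hY c (P.vertex (finRotate n i)) -
          hY c (P.vertex i) * hX c (P.vertex (finRotate n i))) * ∑ j, hZ c (P.vertex j) := by
      have : ∀ j, hDet c (P.vertex i) (P.vertex (finRotate n i)) (P.vertex j) =
        (hX c (P.vertex i) * hY c (P.vertex (finRotate n i)) -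
          hY c (P.vertex i) * hX c (P.vertex (finRotate n i))) * hZ c (P.vertex j) +
        (hY c (P.vertex i) * h - h * hY c (P.vertex (finRotate n i))) * hX c (P.vertex j) +
        (h * hX c (P.vertex (finRotate n i)) - hX c (P.vertex i) * h) * hY c (P.vertex j) := by
        intro j
        unfold hDet tripleDet
        rw [hheight i, hheight (finRotate n i)]
        ring
      simp_rw [this]
      rw [Finset.sum_add_distrib, Finset.sum_add_distrib, ← Finset.mul_sum, ← Finset.mul_sum,
        ← Finset.mul_sum, hcX, hcY]
      ring
    have h2 : 0 < ∑ j, hDet c (P.vertex i) (P.vertex (finRotate n i)) (P.vertex j) := by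
      refine Finset.sum_pos' (fun j _ => ?_) ⟨_, Finset.mem_univ _, P.hDet_consecutive_pos c i⟩
      by_cases hj : j = i
      · rw [hj, hDet_self_left]
      by_cases hj' : j = finRotate n i
      · rw [hj', hDet_self_right]
      exact (P.hDet_pos c hj hj').le
    rw [h1] at h2
    exact pos_of_mul_pos_left h2 hZsum.le
  have hr0 : 0 < h ^ 2 - 1 := by
    rw [← hnorm i₀]
    by_contra hcon
    have h1 : hX c (P.vertex i₀) = 0 := by
      nlinarith [sq_nonneg (hX c (P.vertex i₀)), sq_nonneg (hY c (P.vertex i₀))]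
    have h2 : hY c (P.vertex i₀) = 0 := by
      nlinarith [sq_nonneg (hX c (P.vertex i₀)), sq_nonneg (hY c (P.vertex i₀))]
    have := hpos i₀
    rw [h1, h2] at this
    simp at this
  obtain ⟨ρ, hρ0, hρ⟩ : ∃ ρ, 0 < ρ ∧ ρ ^ 2 = h ^ 2 - 1 :=
    ⟨√(h ^ 2 - 1), Real.sqrt_pos.2 hr0, Real.sq_sqrt hr0.le⟩
  obtain ⟨s, hs⟩ : ∃ s, s = h ^ 2 - Real.cosh (P.sideLength i₀) := ⟨_, rfl⟩
  rw [← hs] at hcons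
  rw [← hρ] at hnorm
  have hsq : ∀ i, (hX c (P.vertex i) * hY c (P.vertex (finRotate n i)) -
      hY c (P.vertex i) * hX c (P.vertex (finRotate n i))) ^ 2 = ρ ^ 4 - s ^ 2 := by
    intro i
    rw [← hcons i]
    linear_combination (hX c (P.vertex i) ^ 2 + hY c (P.vertex i) ^ 2) * hnorm (finRotate n i)
      + ρ ^ 2 * hnorm i
  have hs1 : s ^ 2 < ρ ^ 4 := by
    have := hsq i₀
    have := pow_pos (hpos i₀) 2
    linarith
  -- `2 * η` is the central angle of a side
  obtain ⟨η, hη0, hηπ, hη⟩ : ∃ η, 0 < η ∧ η < Real.pi / 2 ∧ ρ ^ 2 * Real.cos (2 * η) = s := by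
    have hlt : |s| < ρ ^ 2 := by
      apply abs_lt_of_sq_lt_sq _ (by positivity)
      nlinarith
    rw [abs_lt] at hlt
    have hρ2 : 0 < ρ ^ 2 := by positivity
    refine ⟨Real.arccos (s / ρ ^ 2) / 2, ?_, ?_, ?_⟩
    · have : 0 < Real.arccos (s / ρ ^ 2) := Real.arccos_pos.2 (by rw [div_lt_one hρ2]; exact hlt.2)
      linarith
    · have : Real.arccos (s / ρ ^ 2) < Real.pi := by
        rw [Real.arccos_lt_pi, lt_div_iff₀ hρ2]; linarith
      linarith
    · rw [mul_div_cancel₀ _ (two_ne_zero), Real.cos_arccos]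
      · field_simp
      · rw [le_div_iff₀ hρ2]; linarith
      · rw [div_le_one hρ2]; linarith
  have hsin : ∀ i, hX c (P.vertex i) * hY c (P.vertex (finRotate n i)) -
      hY c (P.vertex i) * hX c (P.vertex (finRotate n i)) = ρ ^ 2 * Real.sin (2 * η) := by
    intro i
    have h1 : 0 < Real.sin (2 * η) := Real.sin_pos_of_pos_of_lt_pi (by linarith) (by linarith)
    refine (sq_eq_sq₀ (hpos i).le (by positivity)).1 ?_
    rw [hsq, ← hη]
    linear_combination -ρ ^ 4 * Real.sin_sq_add_cos_sq (2 * η)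
  obtain ⟨φ, hφX, hφY⟩ : ∃ φ, hX c (P.vertex i₀) = ρ * Real.cos φ ∧
      hY c (P.vertex i₀) = ρ * Real.sin φ := by
    have hz : ‖(⟨hX c (P.vertex i₀), hY c (P.vertex i₀)⟩ : ℂ)‖ = ρ := by
      rw [Complex.norm_eq_sqrt_sq_add_sq, hnorm i₀, Real.sqrt_sq hρ0.le]
    refine ⟨Complex.arg ⟨hX c (P.vertex i₀), hY c (P.vertex i₀)⟩, ?_, ?_⟩
    · rw [← hz, Complex.norm_mul_cos_arg]
    · rw [← hz, Complex.norm_mul_sin_arg]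
  have hpolar : ∀ d : ℕ,
      hX c (P.vertex (((finRotate n) ^ d) i₀)) = ρ * Real.cos (φ + d * (2 * η)) ∧
      hY c (P.vertex (((finRotate n) ^ d) i₀)) = ρ * Real.sin (φ + d * (2 * η)) := by
    intro d
    induction d with
    | zero => simpa using ⟨hφX, hφY⟩
    | succ d ih =>
      obtain ⟨ih1, ih2⟩ := ih
      have e1 := hcons (((finRotate n) ^ d) i₀)
      have e2 := hsin (((finRotate n) ^ d) i₀)
      have e3 := hnorm (((finRotate n) ^ d) i₀)
      rw [pow_succ', Equiv.Perm.mul_apply]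
      push_cast
      rw [show φ + (d + 1) * (2 * η) = φ + d * (2 * η) + 2 * η by ring, Real.cos_add _ (2 * η),
        Real.sin_add _ (2 * η)]
      rw [ih1, ih2] at e1 e2 e3
      have hρ2 : ρ ≠ 0 := hρ0.ne'
      rw [← hη] at e1
      have e3' := Real.sin_sq_add_cos_sq (φ + d * (2 * η))
      generalize Real.cos (φ + d * (2 * η)) = C at *
      generalize Real.sin (φ + d * (2 * η)) = S at *
      constructor <;> apply mul_left_cancel₀ hρ2
      · linear_combination C * e1 - S * e2 -
          ρ * hX c (P.vertex (finRotate n (((finRotate n) ^ d) i₀))) * e3'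
      · linear_combination S * e1 + C * e2 -
          ρ * hY c (P.vertex (finRotate n (((finRotate n) ^ d) i₀))) * e3'
  -- the polygon closes after `n` steps, and convexity excludes more than one turn
  have hlt := angle_lt_pi_of_sin_pos (n := n) hη0 (by linarith [Real.pi_pos]) (by
    intro d hd hdn
    have hd' : ((finRotate n ^ d) i₀ : ℕ) = d := by
      rw [val_finRotate_pow]; simpa [hi₀] using Nat.mod_eq_of_lt hdn
    have h1' : (finRotate n i₀ : ℕ) = 1 := by
      rw [val_finRotate]; simpa [hi₀] using Nat.mod_eq_of_lt (by omega : 1 < n)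
    have := P.hDet_pos c (i := i₀) (j := (finRotate n ^ d) i₀)
      (by intro hh; rw [hh] at hd'; simp [hi₀] at hd'; omega)
      (by intro hh; rw [hh, h1'] at hd'; omega)
    have p1 := hpolar 1
    rw [pow_one, Nat.cast_one, one_mul] at p1
    unfold hDet at this
    rw [hheight, hheight, hheight, hφX, hφY, p1.1, p1.2, (hpolar d).1, (hpolar d).2,
      circle_det_vertex, show (φ + d * (2 * η) - φ) / 2 = d * η by ring] at this
    have h0 : 0 < h := hZ_pos _ _
    exact pos_of_mul_pos_right this (by positivity))
  have hηn : η = Real.pi / n := by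
    have hid : ((finRotate n) ^ n) i₀ = i₀ := Fin.ext (by
      rw [val_finRotate_pow, Nat.add_mod_right, Nat.mod_eq_of_lt i₀.isLt])
    have pn := hpolar n
    rw [hid, hφX, hφY] at pn
    have h1 : Real.cos (n * (2 * η)) = 1 := by
      have e1 := mul_left_cancel₀ hρ0.ne' pn.1
      have e2 := mul_left_cancel₀ hρ0.ne' pn.2
      have : Real.cos (n * (2 * η)) = Real.cos (φ + n * (2 * η) - φ) := by ring_nf
      rw [this, Real.cos_sub, ← e1, ← e2]
      linarith [Real.sin_sq_add_cos_sq φ]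
    rw [Real.cos_eq_one_iff] at h1
    obtain ⟨m, hm⟩ := h1
    have h2 := hlt (n - 1) (by omega) (by omega)
    rw [Nat.cast_sub (by omega), Nat.cast_one] at h2
    have hn0 : (0 : ℝ) < n := by exact_mod_cast (by omega : 0 < n)
    have hpi := Real.pi_pos
    have hm0 : 0 < m := by
      have : 0 < (m : ℝ) * (2 * Real.pi) := by rw [hm]; positivity
      exact_mod_cast pos_of_mul_pos_left this (by positivity)
    have hm2 : m < 2 := by
      by_contra hcon
      have : (2 : ℝ) ≤ m := by exact_mod_cast not_lt.1 hcon
      nlinarith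
    have : m = 1 := by omega
    rw [this] at hm
    rw [eq_div_iff hn0.ne']
    push_cast at hm
    linarith
  refine ⟨c, ρ, φ, hρ0, fun i => ?_⟩
  have := hpolar i
  rwa [show ((finRotate n) ^ (i : ℕ)) i₀ = i from Fin.ext (by
      rw [val_finRotate_pow]; simpa [hi₀] using Nat.mod_eq_of_lt i.isLt), hηn] at this

/-! ### Trigonometry and existence of regular polygons -/

lemma pi_div_bounds {n : ℕ} (hn : 3 ≤ n) : 0 < Real.pi / n ∧ Real.pi / n ≤ Real.pi / 3 := by
  have hn' : (3 : ℝ) ≤ n := by exact_mod_cast hn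
  exact ⟨by positivity, by gcongr⟩

lemma sin_pi_div_pos {n : ℕ} (hn : 3 ≤ n) : 0 < Real.sin (Real.pi / n) := by
  obtain ⟨h1, h2⟩ := pi_div_bounds hn
  exact Real.sin_pos_of_pos_of_lt_pi h1 (by linarith [Real.pi_pos])

lemma cos_pi_div_pos {n : ℕ} (hn : 3 ≤ n) : 0 < Real.cos (Real.pi / n) := by
  obtain ⟨h1, h2⟩ := pi_div_bounds hn
  exact Real.cos_pos_of_mem_Ioo ⟨by linarith [Real.pi_pos], by linarith [Real.pi_pos]⟩

/-- Cyclic succession of the vertices advances the polar angle by `2 π / n`, up to full turns. -/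
lemma exists_finRotate_mul {n : ℕ} (i : Fin n) :
    ∃ k : ℤ, ((finRotate n i : ℕ) : ℝ) * (2 * (Real.pi / n)) =
      i * (2 * (Real.pi / n)) + 2 * (Real.pi / n) - k * (2 * Real.pi) := by
  have hn : (n : ℝ) ≠ 0 := by exact_mod_cast i.pos.ne'
  have h := i.isLt
  rw [val_finRotate]
  refine ⟨((i + 1) / n : ℕ), ?_⟩
  have h1 : (((i : ℕ) + 1) % n : ℕ) = (((i : ℕ) + 1 : ℕ) : ℝ) - n * (((i : ℕ) + 1) / n : ℕ) := by
    rw [eq_sub_iff_add_eq]; exact_mod_cast Nat.mod_add_div _ _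
  rw [h1]
  generalize ((i : ℕ) + 1) / n = k
  push_cast
  field_simp

namespace IsCentered

variable {n : ℕ} {c : ℍ} {ρ φ : ℝ} {v : Fin n → ℍ}

lemma hZ_vertex (h : IsCentered c ρ φ v) (i : Fin n) : hZ c (v i) = √(1 + ρ ^ 2) := by
  rw [hZ_eq, (h i).1, (h i).2]
  congr 1
  linear_combination ρ ^ 2 * Real.sin_sq_add_cos_sq (φ + i * (2 * (Real.pi / n)))

lemma succ (h : IsCentered c ρ φ v) (i : Fin n) :
    hX c (v (finRotate n i)) = ρ * Real.cos (φ + i * (2 * (Real.pi / n)) + 2 * (Real.pi / n)) ∧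
    hY c (v (finRotate n i)) = ρ * Real.sin (φ + i * (2 * (Real.pi / n)) + 2 * (Real.pi / n)) := by
  obtain ⟨k, hk⟩ := exists_finRotate_mul i
  rw [(h _).1, (h _).2, hk, ← add_sub_assoc, ← add_assoc, Real.cos_sub_int_mul_two_pi,
    Real.sin_sub_int_mul_two_pi]
  exact ⟨rfl, rfl⟩

lemma cosh_dist (h : IsCentered c ρ φ v) (i : Fin n) :
    Real.cosh (dist (v i) (v (finRotate n i))) = 1 + 2 * ρ ^ 2 * Real.sin (Real.pi / n) ^ 2 := by
  obtain ⟨h1, h2⟩ := h.succ i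
  rw [cosh_dist_eq c, h.hZ_vertex, h.hZ_vertex, (h i).1, (h i).2, h1, h2,
    Real.mul_self_sqrt (by positivity), Real.cos_add _ (2 * (Real.pi / n)),
    Real.sin_add _ (2 * (Real.pi / n)), Real.cos_two_mul]
  linear_combination -2 * ρ ^ 2 * Real.sin_sq_add_cos_sq (Real.pi / n) -
    ρ ^ 2 * (2 * Real.cos (Real.pi / n) ^ 2 - 1) *
      Real.sin_sq_add_cos_sq (φ + i * (2 * (Real.pi / n)))

lemma cosh_dist_succ_succ (h : IsCentered c ρ φ v) (i : Fin n) :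
    Real.cosh (dist (v i) (v (finRotate n (finRotate n i)))) =
      1 + 8 * ρ ^ 2 * (Real.sin (Real.pi / n) * Real.cos (Real.pi / n)) ^ 2 := by
  obtain ⟨h1, h2⟩ := h.succ (finRotate n i)
  obtain ⟨k, hk⟩ := exists_finRotate_mul i
  have e : φ + (finRotate n i : ℕ) * (2 * (Real.pi / n)) + 2 * (Real.pi / n) =
      φ + i * (2 * (Real.pi / n)) + 2 * (2 * (Real.pi / n)) - k * (2 * Real.pi) := by
    rw [hk]; ring
  rw [e, Real.cos_sub_int_mul_two_pi] at h1
  rw [e, Real.sin_sub_int_mul_two_pi] at h2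
  rw [cosh_dist_eq c, h.hZ_vertex, h.hZ_vertex, (h i).1, (h i).2, h1, h2,
    Real.mul_self_sqrt (by positivity), Real.cos_add _ (2 * (2 * (Real.pi / n))),
    Real.sin_add _ (2 * (2 * (Real.pi / n)))]
  have e1 : Real.cos (2 * (2 * (Real.pi / n))) =
      1 - 8 * (Real.sin (Real.pi / n) * Real.cos (Real.pi / n)) ^ 2 := by
    rw [Real.cos_two_mul, Real.cos_sq', Real.sin_two_mul]; ring
  rw [e1]
  linear_combination - ρ ^ 2 * (1 - 8 * (Real.sin (Real.pi / n) * Real.cos (Real.pi / n)) ^ 2) *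
      Real.sin_sq_add_cos_sq (φ + i * (2 * (Real.pi / n)))

lemma cos_angle (h : IsCentered c ρ φ v) (hn : 3 ≤ n) (hρ : 0 < ρ) (i : Fin n) :
    Real.cos (angle (v ((finRotate n).symm i)) (v i) (v (finRotate n i))) =
      1 - 2 * (Real.cos (Real.pi / n) ^ 2 / (1 + ρ ^ 2 * Real.sin (Real.pi / n) ^ 2)) := by
  obtain ⟨j, rfl⟩ := (finRotate n).surjective i
  have hS := sin_pi_div_pos hn
  rw [Equiv.symm_apply_apply, HyperbolicPlane.cos_angle, h.cosh_dist, h.cosh_dist,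
    h.cosh_dist_succ_succ, Real.mul_self_sqrt
      (by nlinarith [show 0 < 2 * ρ ^ 2 * Real.sin (Real.pi / n) ^ 2 by positivity])]
  have : (1 + 2 * ρ ^ 2 * Real.sin (Real.pi / n) ^ 2) ^ 2 - 1 =
    4 * ρ ^ 2 * Real.sin (Real.pi / n) ^ 2 * (1 + ρ ^ 2 * Real.sin (Real.pi / n) ^ 2) := by ring
  rw [this]
  field_simp
  rw [Real.cos_sq']
  ring

end IsCentered

namespace ConvexPolygon

variable {n : ℕ} {P : ConvexPolygon n} {c : ℍ} {ρ φ θ : ℝ}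

lemma isRegularWithAngle_of_isCentered (h : IsCentered c ρ φ P.vertex) (hρ : 0 < ρ) :
    P.IsRegularWithAngle (P.interiorAngle ⟨0, by have := P.three_le; omega⟩) := by
  constructor
  · intro i j
    unfold sideLength
    rw [← Real.arcosh_cosh (dist_nonneg (x := P.vertex i) (y := P.vertex (finRotate n i))),
      ← Real.arcosh_cosh (dist_nonneg (x := P.vertex j) (y := P.vertex (finRotate n j))),
      h.cosh_dist, h.cosh_dist]
  · intro i
    refine Real.injOn_cos
      ⟨InnerProductGeometry.angle_nonneg _ _, InnerProductGeometry.angle_le_pi _ _⟩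
      ⟨InnerProductGeometry.angle_nonneg _ _, InnerProductGeometry.angle_le_pi _ _⟩ ?_
    exact (h.cos_angle P.three_le hρ _).trans (h.cos_angle P.three_le hρ _).symm

/-- The interior angle in terms of the hyperbolic sine `ρ` of the circumradius. -/
lemma sin_half_angle (hP : P.IsRegularWithAngle θ) (h : IsCentered c ρ φ P.vertex) (hρ : 0 < ρ) :
    0 < θ ∧ θ ≤ Real.pi ∧ Real.sin (θ / 2) =
      Real.cos (Real.pi / n) / √(1 + ρ ^ 2 * Real.sin (Real.pi / n) ^ 2) := by
  have hn := P.three_le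
  have hC := cos_pi_div_pos hn
  have hθ := hP.2 ⟨0, by omega⟩
  have h0 : 0 ≤ θ := by rw [← hθ]; exact InnerProductGeometry.angle_nonneg _ _
  have h1 : θ ≤ Real.pi := by rw [← hθ]; exact InnerProductGeometry.angle_le_pi _ _
  have hcos := h.cos_angle hn hρ ⟨0, by omega⟩
  change Real.cos (P.interiorAngle _) = _ at hcos
  have hs0 : 0 ≤ Real.sin (θ / 2) := Real.sin_nonneg_of_nonneg_of_le_pi (by linarith) (by linarith)
  have hsin : Real.sin (θ / 2) =
      Real.cos (Real.pi / n) / √(1 + ρ ^ 2 * Real.sin (Real.pi / n) ^ 2) := by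
    refine (sq_eq_sq₀ hs0 (by positivity)).1 ?_
    rw [div_pow, Real.sq_sqrt (by positivity)]
    rw [hθ, show θ = 2 * (θ / 2) by ring, Real.cos_two_mul, Real.cos_sq'] at hcos
    linarith
  refine ⟨h0.lt_of_ne ?_, h1, hsin⟩
  rintro rfl
  rw [zero_div, Real.sin_zero] at hsin
  have : 0 < Real.cos (Real.pi / n) / √(1 + ρ ^ 2 * Real.sin (Real.pi / n) ^ 2) := by positivity
  linarith

lemma angle_lt (hP : P.IsRegularWithAngle θ) (h : IsCentered c ρ φ P.vertex) (hρ : 0 < ρ) :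
    θ < ((n : ℝ) - 2) * Real.pi / n := by
  have hn := P.three_le
  have hn0 : (n : ℝ) ≠ 0 := by exact_mod_cast (by omega : n ≠ 0)
  have hC := cos_pi_div_pos hn
  have hS := sin_pi_div_pos hn
  obtain ⟨h1, h2⟩ := pi_div_bounds hn
  obtain ⟨h3, h4, h5⟩ := sin_half_angle hP h hρ
  have h6 : Real.sin (θ / 2) < Real.sin (Real.pi / 2 - Real.pi / n) := by
    rw [h5, Real.sin_pi_div_two_sub, div_lt_iff₀ (by positivity)]
    refine lt_mul_of_one_lt_right hC (Real.lt_sqrt_of_sq_lt ?_)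
    have : 0 < ρ ^ 2 * Real.sin (Real.pi / n) ^ 2 := by positivity
    linarith
  have h7 := (Real.strictMonoOn_sin.lt_iff_lt ⟨by linarith, by linarith⟩
    ⟨by linarith, by linarith⟩).1 h6
  have : ((n : ℝ) - 2) * Real.pi / n = 2 * (Real.pi / 2 - Real.pi / n) := by field_simp
  rw [this]; linarith

/-- The half side of a regular polygon with interior angle `θ` is `g n θ`. -/
lemma perim_eq (hP : P.IsRegularWithAngle θ) (h : IsCentered c ρ φ P.vertex) (hρ : 0 < ρ) :
    P.perim = 2 * n * g n θ := by
  have hC := cos_pi_div_pos P.three_le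
  obtain ⟨h3, h4, h5⟩ := sin_half_angle hP h hρ
  have h6 : Real.cos (Real.pi / n) / Real.sin (θ / 2) =
      √(1 + ρ ^ 2 * Real.sin (Real.pi / n) ^ 2) := by
    rw [h5]; field_simp
  have h7 : 1 ≤ √(1 + ρ ^ 2 * Real.sin (Real.pi / n) ^ 2) :=
    Real.one_le_sqrt.2 (le_add_of_nonneg_right (by positivity))
  have hside : ∀ i, P.sideLength i = 2 * g n θ := by
    intro i
    refine Real.cosh_injOn dist_nonneg (?_ : 0 ≤ 2 * g n θ) ?_
    · unfold g
      rw [h6]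
      have := Real.arcosh_nonneg h7
      positivity
    · rw [h.cosh_dist, Real.cosh_two_mul, Real.sinh_sq, g, h6, Real.cosh_arcosh h7,
        Real.sq_sqrt (by positivity)]
      ring
  unfold perim
  simp_rw [hside]
  rw [Finset.sum_const, Finset.card_univ, Fintype.card_fin, nsmul_eq_mul]
  ring

end ConvexPolygon

/-- There are regular polygons with any given circumcentre and circumradius. -/
lemma exists_polygon_of_radius {n : ℕ} (hn : 3 ≤ n) (c : ℍ) {ρ : ℝ} (hρ : 0 < ρ) :
    ∃ P : ConvexPolygon n, IsCentered c ρ 0 P.vertex := by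
  have hn0 : (0 : ℝ) < n := by exact_mod_cast (by omega : 0 < n)
  obtain ⟨v, hv⟩ : ∃ v : Fin n → ℍ, IsCentered c ρ 0 v :=
    ⟨fun i => ofXY c (ρ * Real.cos (0 + i * (2 * (Real.pi / n))))
      (ρ * Real.sin (0 + i * (2 * (Real.pi / n)))), fun i => ⟨hX_ofXY _ _ _, hY_ofXY _ _ _⟩⟩
  refine ⟨⟨v, hn, fun i j hji hji' => (side_pos_iff c _ _ _).2 ?_⟩, hv⟩
  unfold hDet
  rw [hv.hZ_vertex, hv.hZ_vertex, hv.hZ_vertex, (hv i).1, (hv i).2, (hv.succ i).1, (hv.succ i).2,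
    (hv j).1, (hv j).2, circle_det_vertex]
  refine mul_pos (by positivity) ?_
  have hS := sin_pi_div_pos hn
  rw [mul_assoc]
  refine mul_pos hS ?_
  have e : (0 + (j : ℝ) * (2 * (Real.pi / n)) - (0 + i * (2 * (Real.pi / n)))) / 2 =
    ((j : ℝ) - i) / n * Real.pi := by ring
  have e' : ((j : ℝ) - i) / n * Real.pi - Real.pi / n = ((j : ℝ) - i - 1) / n * Real.pi := by ring
  rw [e, e']
  have hi := i.isLt
  have hj := j.isLt
  have hpi := Real.pi_pos
  -- the two sines have the same sign, that of `j - i`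
  rcases lt_or_ge (i : ℕ) (j : ℕ) with hlt | hge
  · have h2 : (i : ℕ) + 1 < j := by
      refine lt_of_le_of_ne hlt fun hh => hji' (Fin.ext ?_)
      rw [val_finRotate, hh, Nat.mod_eq_of_lt hj]
    have h2' : (i : ℝ) + 1 < j := by exact_mod_cast h2
    have h3 : (j : ℝ) < n := by exact_mod_cast hj
    have h4 : (0 : ℝ) ≤ i := by positivity
    refine mul_pos (Real.sin_pos_of_pos_of_lt_pi ?_ ?_) (Real.sin_pos_of_pos_of_lt_pi ?_ ?_)
    · exact mul_pos (div_pos (by linarith) hn0) hpi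
    · exact mul_lt_of_lt_one_left hpi ((div_lt_one hn0).2 (by linarith))
    · exact mul_pos (div_pos (by linarith) hn0) hpi
    · exact mul_lt_of_lt_one_left hpi ((div_lt_one hn0).2 (by linarith))
  · have h1 : (j : ℕ) < i := lt_of_le_of_ne hge fun hh => hji (Fin.ext hh)
    have h2 : (i : ℕ) + 1 - j < n := by
      by_contra hcon
      have : (i : ℕ) + 1 = n ∧ (j : ℕ) = 0 := by omega
      refine hji' (Fin.ext ?_)
      rw [val_finRotate, this.1, this.2, Nat.mod_self]
    have h2' : (i : ℝ) + 1 < n + j := by exact_mod_cast (by omega : (i : ℕ) + 1 < n + j)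
    have h1' : (j : ℝ) < i := by exact_mod_cast h1
    have neg : ∀ t : ℝ, t < 0 → -n < t → Real.sin (t / n * Real.pi) < 0 := fun t ht ht' =>
      Real.sin_neg_of_neg_of_neg_pi_lt
        (mul_neg_of_neg_of_pos (div_neg_of_neg_of_pos ht hn0) hpi) (by
        have : -1 < t / n := by rw [lt_div_iff₀ hn0]; linarith
        nlinarith)
    exact mul_pos_of_neg_of_neg (neg _ (by linarith) (by linarith))
      (neg _ (by linarith) (by linarith))

/-- There are regular polygons with any given centre and any interior angle below the Euclidean one;
the circumradius depends on the angle only. -/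
lemma exists_polygon_of_angle {n : ℕ} (hn : 3 ≤ n) {θ : ℝ} (h0 : 0 < θ)
    (h1 : θ < ((n : ℝ) - 2) * Real.pi / n) :
    ∃ ρ : ℝ, 0 < ρ ∧ ∀ c : ℍ, ∃ P : ConvexPolygon n,
      IsCentered c ρ 0 P.vertex ∧ P.IsRegularWithAngle θ := by
  have hn0 : (0 : ℝ) < n := by exact_mod_cast (by omega : 0 < n)
  have hC := cos_pi_div_pos hn
  have hS := sin_pi_div_pos hn
  obtain ⟨h3, h2⟩ := pi_div_bounds hn
  have hM : ((n : ℝ) - 2) * Real.pi / n = 2 * (Real.pi / 2 - Real.pi / n) := by field_simp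
  rw [hM] at h1
  have hs0 : 0 < Real.sin (θ / 2) := Real.sin_pos_of_pos_of_lt_pi (by linarith) (by linarith)
  have hs1 : Real.sin (θ / 2) < Real.cos (Real.pi / n) := by
    rw [← Real.sin_pi_div_two_sub]
    exact Real.strictMonoOn_sin ⟨by linarith, by linarith⟩ ⟨by linarith, by linarith⟩ (by linarith)
  have hq : 1 < Real.cos (Real.pi / n) / Real.sin (θ / 2) := (one_lt_div hs0).2 hs1
  have hq' : 0 < (Real.cos (Real.pi / n) / Real.sin (θ / 2)) ^ 2 - 1 := by nlinarith
  have hρ : 0 < √((Real.cos (Real.pi / n) / Real.sin (θ / 2)) ^ 2 - 1) /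
      Real.sin (Real.pi / n) := by
    positivity
  refine ⟨_, hρ, fun c => ?_⟩
  obtain ⟨P, hP⟩ := exists_polygon_of_radius hn c hρ
  refine ⟨P, hP, ?_⟩
  have hreg := ConvexPolygon.isRegularWithAngle_of_isCentered hP hρ
  obtain ⟨h4, h5, h6⟩ := ConvexPolygon.sin_half_angle hreg hP hρ
  have h7 := ConvexPolygon.angle_lt hreg hP hρ
  rw [hM] at h7
  rw [div_pow, Real.sq_sqrt hq'.le, div_mul_cancel₀ _ (by positivity), add_sub_cancel,
    Real.sqrt_sq (by positivity), div_div_cancel₀ hC.ne'] at h6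
  have := Real.injOn_sin ⟨by linarith, by linarith⟩ ⟨by linarith, by linarith⟩ h6
  rwa [show P.interiorAngle ⟨0, by omega⟩ = θ by linarith] at hreg

/-! ### The area form in hyperboloid coordinates -/

/-- The first two hyperboloid coordinates as a function of the real and the imaginary part. -/
def chart (c : ℍ) (p : ℝ × ℝ) : ℝ × ℝ :=
  ((p.1 - c.re) / p.2, ((p.1 - c.re) ^ 2 + p.2 ^ 2 - c.im ^ 2) / (2 * p.2 * c.im))

/-- The derivative of `chart c` at `p`. -/
def chartDeriv (c : ℍ) (p : ℝ × ℝ) : ℝ × ℝ →L[ℝ] ℝ × ℝ :=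
  LinearMap.toContinuousLinearMap
    (Matrix.toLin (Module.Basis.finTwoProd ℝ) (Module.Basis.finTwoProd ℝ)
    !![1 / p.2, -(p.1 - c.re) / p.2 ^ 2;
      (p.1 - c.re) / (p.2 * c.im), (p.2 ^ 2 + c.im ^ 2 - (p.1 - c.re) ^ 2) / (2 * p.2 ^ 2 * c.im)])

lemma hasFDerivAt_chart (c : ℍ) {p : ℝ × ℝ} (hp : 0 < p.2) :
    HasFDerivAt (chart c) (chartDeriv c p) p := by
  have hc := c.im_pos
  unfold chartDeriv
  rw [Matrix.toLin_finTwoProd_toContinuousLinearMap]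
  have h1 : HasFDerivAt (fun p : ℝ × ℝ => p.1) (ContinuousLinearMap.fst ℝ ℝ ℝ) p :=
    hasFDerivAt_fst
  have h2 : HasFDerivAt (fun p : ℝ × ℝ => p.2) (ContinuousLinearMap.snd ℝ ℝ ℝ) p :=
    hasFDerivAt_snd
  have h1' := h1.sub_const c.re
  have hi : HasFDerivAt (fun p : ℝ × ℝ => (p.2)⁻¹)
      (-(p.2 ^ 2)⁻¹ • ContinuousLinearMap.snd ℝ ℝ ℝ) p :=
    (hasDerivAt_inv hp.ne').comp_hasFDerivAt p h2
  have e1 := h1'.fun_mul hi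
  have e2 := ((((h1'.fun_mul h1').fun_add (h2.fun_mul h2)).sub_const (c.im ^ 2)).fun_mul
    hi).mul_const (1 / (2 * c.im))
  refine ((e1.prodMk e2).congr_fderiv ?_).congr_of_eventuallyEq (Filter.Eventually.of_forall ?_)
  · ext <;> simp <;> field_simp <;> ring
  · intro q
    unfold chart
    ext
    · simp [div_eq_mul_inv]
    · simp [div_eq_mul_inv]; ring

/-- The Jacobian determinant of `chart c` is the third hyperboloid coordinate divided by `y ^ 2`. -/
lemma det_chartDeriv (c : ℍ) {p : ℝ × ℝ} (hp : 0 < p.2) :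
    (chartDeriv c p).det =
      ((p.1 - c.re) ^ 2 + p.2 ^ 2 + c.im ^ 2) / (2 * p.2 * c.im) / p.2 ^ 2 := by
  have hc := c.im_pos
  unfold chartDeriv
  rw [LinearMap.det_toContinuousLinearMap, LinearMap.det_toLin, Matrix.det_fin_two_of]
  field_simp
  ring

lemma chart_coe (c z : ℍ) : chart c (z.re, z.im) = (hX c z, hY c z) := rfl

/-- In hyperboloid coordinates the area form is `dX dY / Z`. -/
lemma volume_eq_lintegral_chart (c : ℍ) {s : Set ℍ} (hs : MeasurableSet s) :
    volume s = ∫⁻ p in {p : ℝ × ℝ | ofXY c p.1 p.2 ∈ s},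
      ENNReal.ofReal (1 / √(1 + p.1 ^ 2 + p.2 ^ 2)) := by
  set T : Set (ℝ × ℝ) := Complex.measurableEquivRealProd.symm ⁻¹' ((↑) '' s) with hT
  have hTs : MeasurableSet T :=
    Complex.measurableEquivRealProd.symm.measurable
      (measurableEmbedding_coe.measurableSet_image.2 hs)
  have hmem : ∀ p ∈ T, ∃ z ∈ s, p = (z.re, z.im) := by
    rintro p ⟨z, hz, hzp⟩
    refine ⟨z, hz, ?_⟩
    have : p = Complex.measurableEquivRealProd (z : ℂ) := by
      rw [hzp]; simp
    rw [this]; rfl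
  have hmem' : ∀ z ∈ s, (z.re, z.im) ∈ T := fun z hz => ⟨z, hz, by
    apply Complex.ext <;> rfl⟩
  have himage : {p : ℝ × ℝ | ofXY c p.1 p.2 ∈ s} = chart c '' T := by
    ext p
    constructor
    · intro hp
      refine ⟨_, hmem' _ hp, ?_⟩
      rw [chart_coe, hX_ofXY, hY_ofXY]
    · rintro ⟨q, hq, rfl⟩
      obtain ⟨z, hz, rfl⟩ := hmem q hq
      rw [chart_coe]
      simpa [ofXY_hX_hY] using hz
  have hinj : Set.InjOn (chart c) T := by
    intro p hp q hq hpq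
    obtain ⟨z, hz, rfl⟩ := hmem p hp
    obtain ⟨w, hw, rfl⟩ := hmem q hq
    rw [chart_coe, chart_coe, Prod.mk.injEq] at hpq
    rw [← ofXY_hX_hY c z, hpq.1, hpq.2, ofXY_hX_hY]
  have hpos : ∀ p ∈ T, 0 < p.2 := by
    intro p hp
    obtain ⟨z, hz, rfl⟩ := hmem p hp
    exact z.im_pos
  rw [himage, lintegral_image_eq_lintegral_abs_det_fderiv_mul volume hTs
    (fun p hp => (hasFDerivAt_chart c (hpos p hp)).hasFDerivWithinAt) hinj, volume_eq_lintegral,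
    ← Complex.volume_preserving_equiv_real_prod.symm.setLIntegral_comp_preimage_emb
      Complex.measurableEquivRealProd.symm.measurableEmbedding]
  refine setLIntegral_congr_fun hTs fun p hp => ?_
  have hp2 := hpos p hp
  obtain ⟨z, hz, rfl⟩ := hmem p hp
  rw [det_chartDeriv c hp2, chart_coe]
  change _ = ENNReal.ofReal |hZ c z / z.im ^ 2| *
    ENNReal.ofReal (1 / √(1 + hX c z ^ 2 + hY c z ^ 2))
  have hZ0 := hZ_pos c z
  have h1 := z.im_pos
  rw [← hZ_eq, abs_of_pos (by positivity), ← ENNReal.ofReal_mul (by positivity)]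
  change ((((1 / ‖z.im‖₊) ^ 2 : NNReal) : ENNReal)) = _
  rw [← ENNReal.ofReal_coe_nnreal]
  congr 1
  push_cast
  rw [Real.norm_of_nonneg h1.le]
  field_simp

/-! ### Polar coordinates for the region of a regular polygon -/

@[fun_prop]
lemma continuous_hX (c : ℍ) : Continuous (hX c) := by
  unfold hX
  exact (UpperHalfPlane.continuous_re.sub continuous_const).div UpperHalfPlane.continuous_im
    fun z => z.im_pos.ne'

@[fun_prop]
lemma continuous_hY (c : ℍ) : Continuous (hY c) := by
  have := UpperHalfPlane.continuous_re
  have := UpperHalfPlane.continuous_im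
  unfold hY
  refine Continuous.div (by fun_prop) (by fun_prop) fun z => ?_
  have := z.im_pos
  have := c.im_pos
  positivity

@[fun_prop]
lemma continuous_hZ (c : ℍ) : Continuous (hZ c) := by
  simp_rw [funext (hZ_eq c)]
  fun_prop

namespace ConvexPolygon

/-- The region is cut out by the half-planes whose normals point to the midpoints of the sides. -/
lemma mem_region_iff {n : ℕ} {P : ConvexPolygon n} {c : ℍ} {ρ φ : ℝ}
    (h : IsCentered c ρ φ P.vertex) (hρ : 0 < ρ) (z : ℍ) :
    z ∈ P.region ↔ ∀ i : Fin n, √(1 + ρ ^ 2) *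
      (hX c z * Real.cos (φ + i * (2 * (Real.pi / n)) + Real.pi / n) +
        hY c z * Real.sin (φ + i * (2 * (Real.pi / n)) + Real.pi / n)) ≤
      ρ * Real.cos (Real.pi / n) * hZ c z := by
  refine forall_congr' fun i => ?_
  have hS := sin_pi_div_pos P.three_le
  rw [side_nonneg_iff c, hDet, h.hZ_vertex, h.hZ_vertex, (h i).1, (h i).2, (h.succ i).1,
    (h.succ i).2, circle_det, mul_nonneg_iff_of_pos_left (by positivity), sub_nonneg]

end ConvexPolygon

/-- The intersection of a regular polygon with the ray from its centre in direction `t`, in terms of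
the hyperbolic sine `r` of the distance from the centre; `ρ` and `φ` are as in `IsCentered`. -/
def radialSection (n : ℕ) (ρ φ t : ℝ) : Set ℝ :=
  {r | 0 < r ∧ ∀ i : Fin n, √(1 + ρ ^ 2) *
    (r * Real.cos (t - (φ + i * (2 * (Real.pi / n)) + Real.pi / n))) ≤
      ρ * Real.cos (Real.pi / n) * √(1 + r ^ 2)}

/-- The density in the direction `t` of the area of a regular polygon in polar coordinates. -/
def radialArea (n : ℕ) (ρ φ t : ℝ) : ENNReal :=
  ∫⁻ r in radialSection n ρ φ t, ENNReal.ofReal (r / √(1 + r ^ 2))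

lemma measurableSet_radialSection (n : ℕ) (ρ φ : ℝ) :
    MeasurableSet {p : ℝ × ℝ | p.1 ∈ radialSection n ρ φ p.2} := by
  have : {p : ℝ × ℝ | p.1 ∈ radialSection n ρ φ p.2} = {p : ℝ × ℝ | 0 < p.1} ∩ ⋂ i : Fin n,
      {p : ℝ × ℝ | √(1 + ρ ^ 2) *
        (p.1 * Real.cos (p.2 - (φ + i * (2 * (Real.pi / n)) + Real.pi / n))) ≤
          ρ * Real.cos (Real.pi / n) * √(1 + p.1 ^ 2)} := by
    ext p
    simp [radialSection]
  rw [this]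
  exact (measurableSet_lt measurable_const measurable_fst).inter
    (MeasurableSet.iInter fun i => measurableSet_le (by fun_prop) (by fun_prop))

lemma ConvexPolygon.area_eq_lintegral_radialArea {n : ℕ} {P : ConvexPolygon n} {c : ℍ} {ρ φ : ℝ}
    (h : IsCentered c ρ φ P.vertex) (hρ : 0 < ρ) :
    P.area = ∫⁻ t in Set.Ioo (-Real.pi) Real.pi, radialArea n ρ φ t := by
  have hmeas : MeasurableSet P.region := by
    rw [show P.region = {z | ∀ i : Fin n, _} from Set.ext fun z => P.mem_region_iff h hρ z]
    simp only [Set.ofPred_forall]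
    exact MeasurableSet.iInter fun i => measurableSet_le (by fun_prop) (by fun_prop)
  set A : Set (ℝ × ℝ) := {p : ℝ × ℝ | ofXY c p.1 p.2 ∈ P.region} with hA
  have hA' : A = {p : ℝ × ℝ | ∀ i : Fin n, √(1 + ρ ^ 2) *
      (p.1 * Real.cos (φ + i * (2 * (Real.pi / n)) + Real.pi / n) +
        p.2 * Real.sin (φ + i * (2 * (Real.pi / n)) + Real.pi / n)) ≤
      ρ * Real.cos (Real.pi / n) * √(1 + p.1 ^ 2 + p.2 ^ 2)} := by
    ext p
    rw [hA, Set.mem_ofPred_eq, P.mem_region_iff h hρ]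
    simp_rw [hZ_eq, hX_ofXY, hY_ofXY]
    rfl
  have hAm : MeasurableSet A := by
    rw [hA']
    simp only [Set.ofPred_forall]
    exact MeasurableSet.iInter fun i => measurableSet_le (by fun_prop) (by fun_prop)
  have hBm := measurableSet_radialSection n ρ φ
  rw [ConvexPolygon.area, volume_eq_lintegral_chart c hmeas, ← lintegral_indicator hAm,
    ← lintegral_comp_polarCoord_symm]
  have key : ∀ p ∈ polarCoord.target, ENNReal.ofReal p.1 • A.indicator
      (fun p => ENNReal.ofReal (1 / √(1 + p.1 ^ 2 + p.2 ^ 2))) (polarCoord.symm p) =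
      {p : ℝ × ℝ | p.1 ∈ radialSection n ρ φ p.2}.indicator
        (fun p => ENNReal.ofReal (p.1 / √(1 + p.1 ^ 2))) p := by
    intro p hp
    have hp1 : 0 < p.1 := hp.1
    have hsq : 1 + (p.1 * Real.cos p.2) ^ 2 + (p.1 * Real.sin p.2) ^ 2 = 1 + p.1 ^ 2 := by
      linear_combination p.1 ^ 2 * Real.sin_sq_add_cos_sq p.2
    have hiff : polarCoord.symm p ∈ A ↔ p.1 ∈ radialSection n ρ φ p.2 := by
      rw [hA', radialSection, Set.mem_ofPred_eq, Set.mem_ofPred_eq]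
      simp only [hp1, true_and, polarCoord_symm_apply, hsq]
      refine forall_congr' fun i => ?_
      rw [Real.cos_sub, mul_assoc p.1, mul_assoc p.1, ← mul_add p.1]
    by_cases hpA : polarCoord.symm p ∈ A
    · rw [Set.indicator_of_mem hpA, Set.indicator_of_mem
        (show p ∈ {p : ℝ × ℝ | p.1 ∈ radialSection n ρ φ p.2} from hiff.1 hpA)]
      simp only [polarCoord_symm_apply, hsq, smul_eq_mul]
      rw [← ENNReal.ofReal_mul hp1.le, mul_one_div]
    · rw [Set.indicator_of_notMem hpA, Set.indicator_of_notMem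
        (show p ∉ {p : ℝ × ℝ | p.1 ∈ radialSection n ρ φ p.2} from fun hh => hpA (hiff.2 hh)),
        smul_zero]
  rw [setLIntegral_congr_fun polarCoord.open_target.measurableSet key]
  have : polarCoord.target = Set.Ioi 0 ×ˢ Set.Ioo (-Real.pi) Real.pi := rfl
  rw [this, Measure.volume_eq_prod, ← Measure.prod_restrict, lintegral_prod_symm']
  · refine lintegral_congr fun t => ?_
    have hsm : MeasurableSet (radialSection n ρ φ t) :=
      measurable_id.prodMk measurable_const hBm
    rw [radialArea, ← lintegral_indicator hsm, ← lintegral_indicator measurableSet_Ioi]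
    refine lintegral_congr fun r => ?_
    by_cases hr : r ∈ radialSection n ρ φ t
    · rw [Set.indicator_of_mem hr, Set.indicator_of_mem (show r ∈ Set.Ioi 0 from hr.1)]
      exact Set.indicator_of_mem (s := {p : ℝ × ℝ | p.1 ∈ radialSection n ρ φ p.2}) hr _
    · rw [Set.indicator_of_notMem hr]
      refine Set.indicator_apply_eq_zero.2 fun _ => ?_
      exact Set.indicator_of_notMem (s := {p : ℝ × ℝ | p.1 ∈ radialSection n ρ φ p.2}) hr _
  · exact Measurable.indicator (by fun_prop) hBm

lemma radialSection_periodic {n : ℕ} (ρ φ t : ℝ) :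
    radialSection n ρ φ (t + 2 * (Real.pi / n)) = radialSection n ρ φ t := by
  ext r
  unfold radialSection
  rw [Set.mem_ofPred_eq, Set.mem_ofPred_eq]
  refine and_congr_right fun _ => ?_
  rw [← (finRotate n).forall_congr_right]
  refine forall_congr' fun i => ?_
  obtain ⟨k, hk⟩ := exists_finRotate_mul i
  rw [hk, show t + 2 * (Real.pi / n) - (φ + (i * (2 * (Real.pi / n)) + 2 * (Real.pi / n) -
    k * (2 * Real.pi)) + Real.pi / n) = t - (φ + i * (2 * (Real.pi / n)) + Real.pi / n) +
    k * (2 * Real.pi) by ring, Real.cos_add_int_mul_two_pi]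

lemma radialArea_periodic (n : ℕ) (ρ φ : ℝ) :
    Function.Periodic (radialArea n ρ φ) (2 * (Real.pi / n)) := fun t => by
  unfold radialArea
  rw [radialSection_periodic]

lemma lintegral_radial {R : ℝ} (hR : 0 ≤ R) :
    ∫⁻ r in Set.Ioc 0 R, ENNReal.ofReal (r / √(1 + r ^ 2)) = ENNReal.ofReal (√(1 + R ^ 2) - 1) := by
  have hcont : Continuous fun r : ℝ => r / √(1 + r ^ 2) :=
    continuous_id.div (by fun_prop) fun r => by positivity
  have hder : ∀ r : ℝ, HasDerivAt (fun r : ℝ => √(1 + r ^ 2)) (r / √(1 + r ^ 2)) r := fun r => by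
    have h1 : HasDerivAt (fun r : ℝ => 1 + r ^ 2) (2 * r) r := by
      simpa using (hasDerivAt_pow 2 r).const_add 1
    convert! h1.sqrt (by positivity) using 1
    rw [mul_div_mul_left _ _ two_ne_zero]
  rw [← ofReal_integral_eq_lintegral_ofReal, ← intervalIntegral.integral_of_le hR,
    intervalIntegral.integral_eq_sub_of_hasDerivAt (fun r _ => hder r)
      (hcont.intervalIntegrable _ _)]
  · simp
  · exact (hcont.intervalIntegrable 0 R).1
  · filter_upwards [ae_restrict_mem measurableSet_Ioc] with r hr
    have := hr.1
    positivity

/-- Among the midpoints of the sides, the one closest in direction to a direction in the first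
sector is that of the first side. -/
lemma cos_sub_le_cos {n : ℕ} (i : Fin n) {s : ℝ} (hs : |s| ≤ Real.pi / n) :
    Real.cos (s - i * (2 * (Real.pi / n))) ≤ Real.cos s := by
  have hn : (0 : ℝ) < n := by exact_mod_cast i.pos
  rw [abs_le] at hs
  rcases Nat.eq_zero_or_pos (i : ℕ) with h0 | h0
  · simp [h0]
  have h1 : (1 : ℝ) ≤ i := by exact_mod_cast h0
  have h2 : (i : ℝ) + 1 ≤ n := by exact_mod_cast i.isLt
  have hp : 0 < Real.pi / n := div_pos Real.pi_pos hn
  have hpn : n * (Real.pi / n) = Real.pi := by field_simp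
  have e := Real.cos_sub_cos s (s - i * (2 * (Real.pi / n)))
  rw [show (s + (s - i * (2 * (Real.pi / n)))) / 2 = -(i * (Real.pi / n) - s) by ring,
    show (s - (s - i * (2 * (Real.pi / n)))) / 2 = i * (Real.pi / n) by ring, Real.sin_neg] at e
  have s1 : 0 ≤ Real.sin (i * (Real.pi / n) - s) :=
    Real.sin_nonneg_of_nonneg_of_le_pi (by nlinarith) (by nlinarith)
  have s2 : 0 ≤ Real.sin (i * (Real.pi / n)) :=
    Real.sin_nonneg_of_nonneg_of_le_pi (by positivity) (by nlinarith)
  nlinarith [mul_nonneg s1 s2]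

/-- The hyperbolic cosine, minus one, of the distance from the centre to a side, measured along the
ray at angle `s` from the perpendicular to that side. -/
def sectorDensity (n : ℕ) (ρ s : ℝ) : ℝ :=
  √(1 + ρ ^ 2) * Real.cos s /
    √(1 + ρ ^ 2 * Real.sin (Real.pi / n) ^ 2 - (1 + ρ ^ 2) * Real.sin s ^ 2) - 1

lemma cos_pi_div_le_cos {n : ℕ} (hn : 3 ≤ n) {s : ℝ} (hs : |s| ≤ Real.pi / n) :
    Real.cos (Real.pi / n) ≤ Real.cos s := by
  obtain ⟨h1, h2⟩ := pi_div_bounds hn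
  rw [← Real.cos_abs s]
  exact Real.cos_le_cos_of_nonneg_of_le_pi (abs_nonneg s) (by linarith [Real.pi_pos]) hs

lemma sectorDensity_radicand_pos {n : ℕ} (hn : 3 ≤ n) (ρ : ℝ) {s : ℝ} (hs : |s| ≤ Real.pi / n) :
    0 < 1 + ρ ^ 2 * Real.sin (Real.pi / n) ^ 2 - (1 + ρ ^ 2) * Real.sin s ^ 2 := by
  have h1 := cos_pi_div_le_cos hn hs
  have h2 := cos_pi_div_pos hn
  have h3 : Real.sin s ^ 2 ≤ Real.sin (Real.pi / n) ^ 2 := by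
    rw [Real.sin_sq, Real.sin_sq]; nlinarith
  have h4 := Real.sin_sq_add_cos_sq (Real.pi / n)
  nlinarith [sq_nonneg ρ, pow_pos h2 2]

lemma radialArea_eq {n : ℕ} (hn : 3 ≤ n) {ρ : ℝ} (hρ : 0 < ρ) (φ : ℝ) {s : ℝ}
    (hs : |s| ≤ Real.pi / n) :
    radialArea n ρ φ (φ + Real.pi / n + s) = ENNReal.ofReal (sectorDensity n ρ s) := by
  have hq := sectorDensity_radicand_pos hn ρ hs
  have hC := cos_pi_div_pos hn
  have hcs : 0 < Real.cos s := hC.trans_le (cos_pi_div_le_cos hn hs)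
  set q := 1 + ρ ^ 2 * Real.sin (Real.pi / n) ^ 2 - (1 + ρ ^ 2) * Real.sin s ^ 2 with hqdef
  have hq' : q = (1 + ρ ^ 2) * Real.cos s ^ 2 - (ρ * Real.cos (Real.pi / n)) ^ 2 := by
    rw [hqdef, Real.sin_sq, Real.sin_sq]; ring
  set R := ρ * Real.cos (Real.pi / n) / √q with hR
  have hR0 : 0 < R := by positivity
  have hset : radialSection n ρ φ (φ + Real.pi / n + s) = Set.Ioc 0 R := by
    ext r
    refine and_congr_right fun hr => ?_
    have hr' : (0 : ℝ) < r := hr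
    have e : ∀ i : Fin n, φ + Real.pi / n + s - (φ + i * (2 * (Real.pi / n)) + Real.pi / n) =
      s - i * (2 * (Real.pi / n)) := fun i => by ring
    simp_rw [e]
    -- only the nearest side matters
    have step1 : (∀ i : Fin n, √(1 + ρ ^ 2) * (r * Real.cos (s - i * (2 * (Real.pi / n)))) ≤
        ρ * Real.cos (Real.pi / n) * √(1 + r ^ 2)) ↔
        √(1 + ρ ^ 2) * (r * Real.cos s) ≤ ρ * Real.cos (Real.pi / n) * √(1 + r ^ 2) := by
      constructor
      · intro h
        simpa using h ⟨0, by omega⟩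
      · intro h i
        refine le_trans ?_ h
        have := cos_sub_le_cos i hs
        gcongr
    rw [step1, ← sq_le_sq₀ (by positivity) (by positivity), mul_pow, mul_pow _ (√(1 + r ^ 2)),
      Real.sq_sqrt (by positivity), Real.sq_sqrt (by positivity), hR, le_div_iff₀ (by positivity),
      show r * √q ≤ ρ * Real.cos (Real.pi / n) ↔ (r * √q) ^ 2 ≤
        (ρ * Real.cos (Real.pi / n)) ^ 2 from
          (sq_le_sq₀ (by positivity) (by positivity)).symm,
      mul_pow r (√q), Real.sq_sqrt hq.le, hq']
    constructor <;> intro h <;> linarith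
  rw [radialArea, hset, lintegral_radial hR0.le, sectorDensity, ← hqdef]
  congr 2
  rw [← Real.sqrt_sq hcs.le, ← Real.sqrt_mul (by positivity),
    ← Real.sqrt_div (by positivity)]
  congr 1
  rw [hR, div_pow, Real.sq_sqrt hq.le]
  field_simp
  rw [hq']
  ring

/-! ### The area of a regular polygon -/

lemma continuousOn_sectorDensity {n : ℕ} (hn : 3 ≤ n) (ρ : ℝ) :
    ContinuousOn (sectorDensity n ρ) (Set.Icc (-(Real.pi / n)) (Real.pi / n)) := by
  unfold sectorDensity
  refine ContinuousOn.sub (ContinuousOn.div (by fun_prop) (by fun_prop) fun s hs => ?_)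
    continuousOn_const
  have := sectorDensity_radicand_pos hn ρ (abs_le.2 hs)
  positivity

lemma sectorDensity_nonneg {n : ℕ} (hn : 3 ≤ n) (ρ : ℝ) {s : ℝ} (hs : |s| ≤ Real.pi / n) :
    0 ≤ sectorDensity n ρ s := by
  have hq := sectorDensity_radicand_pos hn ρ hs
  have hcs := (cos_pi_div_pos hn).trans_le (cos_pi_div_le_cos hn hs)
  unfold sectorDensity
  rw [sub_nonneg, one_le_div (by positivity)]
  refine Real.sqrt_le_iff.2 ⟨by positivity, ?_⟩
  rw [mul_pow, Real.sq_sqrt (by positivity), Real.sin_sq, Real.sin_sq]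
  nlinarith [sq_nonneg (ρ * Real.cos (Real.pi / n))]

/-- The area of one of the `n` congruent sectors of a regular polygon. -/
lemma integral_sectorDensity {n : ℕ} (hn : 3 ≤ n) (ρ : ℝ) :
    ∫ s in (-(Real.pi / n))..(Real.pi / n), sectorDensity n ρ s =
      2 * Real.arcsin (√(1 + ρ ^ 2) * Real.sin (Real.pi / n) /
        √(1 + ρ ^ 2 * Real.sin (Real.pi / n) ^ 2)) - 2 * (Real.pi / n) := by
  have hp := (pi_div_bounds hn).1
  set q := 1 + ρ ^ 2 * Real.sin (Real.pi / n) ^ 2 with hq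
  have hq0 : 0 < q := by positivity
  have hder : ∀ s ∈ Set.uIcc (-(Real.pi / n)) (Real.pi / n),
      HasDerivAt (fun s => Real.arcsin (√(1 + ρ ^ 2) * Real.sin s / √q) - s)
        (sectorDensity n ρ s) s := by
    intro s hs
    rw [Set.uIcc_of_le (by linarith)] at hs
    have hs' := sectorDensity_radicand_pos hn ρ (abs_le.2 hs)
    rw [← hq] at hs'
    set u := √(1 + ρ ^ 2) * Real.sin s / √q with hu
    have hu2 : 1 - u ^ 2 = (q - (1 + ρ ^ 2) * Real.sin s ^ 2) / q := by
      rw [hu, div_pow, mul_pow, Real.sq_sqrt (by positivity), Real.sq_sqrt hq0.le]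
      field_simp
    have hu3 : 0 < 1 - u ^ 2 := by rw [hu2]; positivity
    have hu1 : HasDerivAt (fun s => √(1 + ρ ^ 2) * Real.sin s / √q)
        (√(1 + ρ ^ 2) * Real.cos s / √q) s :=
      ((Real.hasDerivAt_sin s).const_mul _).div_const _
    have h1 := (Real.hasDerivAt_arcsin (x := u) (by nlinarith) (by nlinarith)).comp s hu1
    refine (h1.sub (hasDerivAt_id s)).congr_deriv ?_
    rw [hu2, Real.sqrt_div hs'.le, sectorDensity, ← hq]
    field_simp
  rw [intervalIntegral.integral_eq_sub_of_hasDerivAt hder]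
  · rw [Real.sin_neg, mul_neg, neg_div, Real.arcsin_neg]
    ring
  · refine ContinuousOn.intervalIntegrable ?_
    rw [Set.uIcc_of_le (by linarith)]
    exact continuousOn_sectorDensity hn ρ

lemma lintegral_radialArea {n : ℕ} (hn : 3 ≤ n) {ρ : ℝ} (hρ : 0 < ρ) (φ : ℝ) :
    ∫⁻ t in Set.Ioo (-Real.pi) Real.pi, radialArea n ρ φ t =
      ENNReal.ofReal (n * (2 * Real.arcsin (√(1 + ρ ^ 2) * Real.sin (Real.pi / n) /
        √(1 + ρ ^ 2 * Real.sin (Real.pi / n) ^ 2)) - 2 * (Real.pi / n))) := by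
  have hn0 : (n : ℝ) ≠ 0 := by exact_mod_cast (by omega : n ≠ 0)
  have hp := (pi_div_bounds hn).1
  have hT : 0 < 2 * (Real.pi / n) := by positivity
  have hper := radialArea_periodic n ρ φ
  have hbase : ∀ t, |t - (φ + Real.pi / n)| ≤ Real.pi / n →
      radialArea n ρ φ t = ENNReal.ofReal (sectorDensity n ρ (t - (φ + Real.pi / n))) := by
    intro t ht
    rw [← radialArea_eq hn hρ φ ht, add_sub_cancel]
  have hne : ∀ t, radialArea n ρ φ t ≠ ⊤ := by
    intro t
    obtain ⟨y, hy, hty⟩ := hper.exists_mem_Ico hT t φ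
    rw [hty, hbase y (abs_le.2 ⟨by linarith [hy.1], by linarith [hy.2]⟩)]
    exact ENNReal.ofReal_ne_top
  set f : ℝ → ℝ := fun t => (radialArea n ρ φ t).toReal with hf
  have hfper : Function.Periodic f (2 * (Real.pi / n)) := fun t => by
    simp only [hf]; rw [hper t]
  have hfbase : Set.EqOn (fun t => sectorDensity n ρ (t - (φ + Real.pi / n))) f
      (Set.uIcc φ (φ + 2 * (Real.pi / n))) := by
    intro t ht
    rw [Set.uIcc_of_le (by linarith)] at ht
    have ht' : |t - (φ + Real.pi / n)| ≤ Real.pi / n :=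
      abs_le.2 ⟨by linarith [ht.1], by linarith [ht.2]⟩
    simp only [hf]
    rw [hbase t ht', ENNReal.toReal_ofReal (sectorDensity_nonneg hn ρ ht')]
  have hint0 : IntervalIntegrable f volume φ (φ + 2 * (Real.pi / n)) := by
    refine IntervalIntegrable.congr (fun t ht => hfbase (Set.uIoc_subset_uIcc ht)) ?_
    refine ContinuousOn.intervalIntegrable ?_
    rw [Set.uIcc_of_le (by linarith)]
    refine (continuousOn_sectorDensity hn ρ).comp (by fun_prop) fun t ht => ?_
    exact ⟨by linarith [ht.1], by linarith [ht.2]⟩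
  have hint := hfper.intervalIntegrable hT.ne' hint0
  have htotal : ∫ t in (-Real.pi)..Real.pi, f t = n * (2 * Real.arcsin (√(1 + ρ ^ 2) *
      Real.sin (Real.pi / n) / √(1 + ρ ^ 2 * Real.sin (Real.pi / n) ^ 2)) - 2 * (Real.pi / n)) := by
    have h1 := hfper.intervalIntegral_add_zsmul_eq n (-Real.pi) hint
    rw [show -Real.pi + (n : ℤ) • (2 * (Real.pi / n)) = Real.pi by
      rw [natCast_zsmul, nsmul_eq_mul]; field_simp; ring] at h1
    rw [h1, hfper.intervalIntegral_add_eq _ φ, ← intervalIntegral.integral_congr hfbase,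
      intervalIntegral.integral_comp_sub_right (fun s => sectorDensity n ρ s),
      ← integral_sectorDensity hn, natCast_zsmul, nsmul_eq_mul]
    congr 2 <;> ring
  rw [← htotal, intervalIntegral.integral_of_le (by linarith [Real.pi_pos]),
    integral_Ioc_eq_integral_Ioo, ofReal_integral_eq_lintegral_ofReal]
  · refine lintegral_congr fun t => (ENNReal.ofReal_toReal (hne t)).symm
  · exact ((hint (-Real.pi) Real.pi).1).mono_set Set.Ioo_subset_Ioc_self
  · exact Filter.Eventually.of_forall fun t => ENNReal.toReal_nonneg

namespace ConvexPolygon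

/-- The Gauss–Bonnet formula for a regular polygon. -/
lemma area_eq {n : ℕ} {P : ConvexPolygon n} {c : ℍ} {ρ φ θ : ℝ} (hP : P.IsRegularWithAngle θ)
    (h : IsCentered c ρ φ P.vertex) (hρ : 0 < ρ) :
    P.area = ENNReal.ofReal (((n : ℝ) - 2) * Real.pi - n * θ) := by
  have hn := P.three_le
  have hn0 : (n : ℝ) ≠ 0 := by exact_mod_cast (by omega : n ≠ 0)
  have hS := sin_pi_div_pos hn
  obtain ⟨h1, h2, h3⟩ := sin_half_angle hP h hρ
  have hcos : √(1 + ρ ^ 2) * Real.sin (Real.pi / n) / √(1 + ρ ^ 2 * Real.sin (Real.pi / n) ^ 2) =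
      Real.sin (Real.pi / 2 - θ / 2) := by
    rw [Real.sin_pi_div_two_sub]
    refine (sq_eq_sq₀ (by positivity)
      (Real.cos_nonneg_of_mem_Icc ⟨by linarith, by linarith⟩)).1 ?_
    rw [Real.cos_sq', h3, div_pow, div_pow, mul_pow, Real.sq_sqrt (by positivity),
      Real.sq_sqrt (by positivity)]
    field_simp
    rw [Real.cos_sq']
    ring
  rw [area_eq_lintegral_radialArea h hρ, lintegral_radialArea hn hρ, hcos,
    Real.arcsin_sin (by linarith) (by linarith)]
  congr 1
  field_simp
  ring

end ConvexPolygon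

/-! ### Disjoint polygons -/

lemma cosh_dist_center (c z : ℍ) : Real.cosh (dist z c) = hZ c z := by
  have h1 : hX c c = 0 := by simp [hX]
  have h2 : hY c c = 0 := by simp [hY]
  have h3 : hZ c c = 1 := by rw [hZ_eq, h1, h2]; simp
  rw [cosh_dist_eq c, h1, h2, h3]
  ring

/-- A regular polygon is contained in its circumscribed disc. -/
lemma ConvexPolygon.cosh_dist_center_le {n : ℕ} {P : ConvexPolygon n} {c : ℍ} {ρ φ : ℝ}
    (h : IsCentered c ρ φ P.vertex) (hρ : 0 < ρ) {z : ℍ} (hz : z ∈ P.region) :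
    Real.cosh (dist z c) ≤ √(1 + ρ ^ 2) := by
  have hn := P.three_le
  have hC := cos_pi_div_pos hn
  have hp := (pi_div_bounds hn).1
  rw [cosh_dist_center, hZ_eq]
  refine Real.sqrt_le_sqrt ?_
  set w : ℂ := ⟨hX c z, hY c z⟩ with hw
  have hX' : hX c z = ‖w‖ * Real.cos (Complex.arg w) := (Complex.norm_mul_cos_arg w).symm
  have hY' : hY c z = ‖w‖ * Real.sin (Complex.arg w) := (Complex.norm_mul_sin_arg w).symm
  have hr : hX c z ^ 2 + hY c z ^ 2 = ‖w‖ ^ 2 := by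
    rw [Complex.sq_norm, Complex.normSq_apply]; simp [hw]; ring
  suffices ‖w‖ ^ 2 ≤ ρ ^ 2 by linarith
  rcases (norm_nonneg w).eq_or_lt with h0 | h0
  · rw [← h0]; nlinarith
  have hmem : ‖w‖ ∈ radialSection n ρ φ (Complex.arg w) := by
    refine ⟨h0, fun i => ?_⟩
    have := (P.mem_region_iff h hρ z).1 hz i
    rw [hZ_eq, show 1 + hX c z ^ 2 + hY c z ^ 2 = 1 + ‖w‖ ^ 2 by linarith, hX', hY'] at this
    rw [Real.cos_sub]
    linarith
  obtain ⟨y, hy, hty⟩ := Function.Periodic.exists_mem_Ico (f := radialSection n ρ φ)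
    (radialSection_periodic ρ φ) (by positivity) (Complex.arg w) φ
  rw [hty] at hmem
  have h1 := hmem.2 ⟨0, by omega⟩
  simp only [Nat.cast_zero, zero_mul, add_zero] at h1
  have h2 := cos_pi_div_le_cos hn (s := y - (φ + Real.pi / n))
    (abs_le.2 ⟨by linarith [hy.1], by linarith [hy.2]⟩)
  have h3 : √(1 + ρ ^ 2) * ‖w‖ ≤ ρ * √(1 + ‖w‖ ^ 2) := by
    refine le_of_mul_le_mul_right ?_ hC
    calc √(1 + ρ ^ 2) * ‖w‖ * Real.cos (Real.pi / n)
        ≤ √(1 + ρ ^ 2) * ‖w‖ * Real.cos (y - (φ + Real.pi / n)) := by gcongr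
      _ ≤ _ := by linarith
  rw [← sq_le_sq₀ (by positivity) (by positivity), mul_pow, mul_pow, Real.sq_sqrt (by positivity),
    Real.sq_sqrt (by positivity)] at h3
  linarith

lemma ConvexPolygon.disjoint_region {n : ℕ} {P Q : ConvexPolygon n} {c d : ℍ} {ρ φ ψ : ℝ}
    (hP : IsCentered c ρ φ P.vertex) (hQ : IsCentered d ρ ψ Q.vertex) (hρ : 0 < ρ)
    (hcd : 2 * Real.arcosh √(1 + ρ ^ 2) < dist c d) : Disjoint P.region Q.region := by
  have hone : 1 ≤ √(1 + ρ ^ 2) := Real.one_le_sqrt.2 (by nlinarith)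
  have key : ∀ {z e : ℍ}, Real.cosh (dist z e) ≤ √(1 + ρ ^ 2) →
      dist z e ≤ Real.arcosh √(1 + ρ ^ 2) := fun {z e} hz => by
    rw [← Real.arcosh_cosh (dist_nonneg (x := z) (y := e))]
    exact (Real.arcosh_le_arcosh (Real.cosh_pos _) (by positivity)).2 hz
  refine Set.disjoint_left.2 fun z hz hz' => ?_
  have h1 := key (P.cosh_dist_center_le hP hρ hz)
  have h2 := key (Q.cosh_dist_center_le hQ hρ hz')
  have h3 := dist_triangle_left c d z
  linarith

lemma exists_dist_gt (c : ℍ) (r : ℝ) : ∃ d : ℍ, r < dist c d := by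
  refine ⟨ofXY c (Real.cosh r) 0, ?_⟩
  by_contra hcon
  rw [not_lt, dist_comm] at hcon
  have h0 : 0 ≤ dist (ofXY c (Real.cosh r) 0) c := dist_nonneg
  have h1 : Real.cosh (dist (ofXY c (Real.cosh r) 0) c) ≤ Real.cosh r :=
    Real.cosh_le_cosh.2 (by rwa [abs_of_nonneg h0, abs_of_nonneg (h0.trans hcon)])
  have h2 := hZ_sq c (ofXY c (Real.cosh r) 0)
  rw [hX_ofXY, ← cosh_dist_center] at h2
  nlinarith [sq_nonneg (hY c (ofXY c (Real.cosh r) 0)), Real.cosh_pos r,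
    Real.cosh_pos (dist (ofXY c (Real.cosh r) 0) c)]

/-! ### The half side as a function of the angle -/

section

open Real Set

/-- The half side of a regular hyperbolic polygon with interior angle `2 * u`, where `2 * D` is the
interior angle of the Euclidean regular polygon with the same number of sides. -/
def halfSide (D u : ℝ) : ℝ := arcosh (sin D / sin u)

/-- Minus the derivative of `halfSide D` at `u`. -/
def halfSideSlope (D u : ℝ) : ℝ := sin D * cos u / (sin u * √(sin D ^ 2 - sin u ^ 2))

variable {D : ℝ}

lemma sin_pos_of_mem {u : ℝ} (hD : D < π / 2) (h0 : 0 < u) (h1 : u ≤ D) : 0 < sin u :=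
  sin_pos_of_pos_of_lt_pi h0 (by linarith [pi_pos])

lemma cos_pos_of_mem {u : ℝ} (hD : D < π / 2) (h0 : 0 ≤ u) (h1 : u ≤ D) : 0 < cos u :=
  cos_pos_of_mem_Ioo ⟨by linarith [pi_pos], by linarith⟩

lemma sin_lt_sin_of_mem {u v : ℝ} (hD : D < π / 2) (h0 : 0 < u) (h : u < v) (h1 : v ≤ D) :
    sin u < sin v :=
  sin_lt_sin_of_lt_of_le_pi_div_two (by linarith [pi_pos]) (by linarith) h

lemma halfSide_self (hD : D < π / 2) (h0 : 0 < D) : halfSide D D = 0 := by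
  unfold halfSide
  rw [div_self (sin_pos_of_mem hD h0 le_rfl).ne', arcosh_zero]

lemma continuousOn_halfSide (hD : D < π / 2) : ContinuousOn (halfSide D) (Ioc 0 D) := by
  unfold halfSide
  refine continuousOn_arcosh.comp (ContinuousOn.div (by fun_prop) (by fun_prop) fun u hu =>
    (sin_pos_of_mem hD hu.1 hu.2).ne') fun u hu => ?_
  have h0 := sin_pos_of_mem hD hu.1 hu.2
  rw [mem_Ici, one_le_div h0]
  exact sin_le_sin_of_le_of_le_pi_div_two (by linarith [hu.1, pi_pos]) hD.le hu.2

lemma hasDerivAt_halfSide {u : ℝ} (hD : D < π / 2) (h0 : 0 < u) (h1 : u < D) :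
    HasDerivAt (halfSide D) (-halfSideSlope D u) u := by
  have hs := sin_pos_of_mem hD h0 h1.le
  have hs' := sin_lt_sin_of_mem hD h0 h1 le_rfl
  have hy : sin D / sin u ∈ Ioi 1 := (one_lt_div hs).2 hs'
  have h2 := (hasDerivAt_arcosh hy).comp u
    (((hasDerivAt_const u (sin D)).div (hasDerivAt_sin u) hs.ne'))
  refine h2.congr_deriv ?_
  have h3 : 0 < sin D ^ 2 - sin u ^ 2 := by nlinarith
  have h4 : √((sin D / sin u) ^ 2 - 1) = √(sin D ^ 2 - sin u ^ 2) / sin u := by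
    rw [show (sin D / sin u) ^ 2 - 1 = (sin D ^ 2 - sin u ^ 2) / sin u ^ 2 by field_simp,
      sqrt_div h3.le, sqrt_sq hs.le]
  rw [h4, halfSideSlope]
  have h5 : 0 < √(sin D ^ 2 - sin u ^ 2) := sqrt_pos.2 h3
  field_simp
  ring

lemma halfSide_antitone {u v : ℝ} (hD : D < π / 2) (h0 : 0 < u) (h : u < v) (h1 : v ≤ D) :
    halfSide D v ≤ halfSide D u := by
  have hs := sin_pos_of_mem hD h0 (h.le.trans h1)
  have hv := sin_pos_of_mem hD (h0.trans h) h1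
  have hsD := sin_pos_of_mem hD (h0.trans (h.trans_le h1)) le_rfl
  have := sin_lt_sin_of_mem hD h0 h h1
  unfold halfSide
  rw [arcosh_le_arcosh (by positivity) (by positivity)]
  gcongr

lemma halfSideSlope_pos {u : ℝ} (hD : D < π / 2) (h0 : 0 < u) (h1 : u < D) :
    0 < halfSideSlope D u := by
  have hs := sin_pos_of_mem hD h0 h1.le
  have hs' := sin_lt_sin_of_mem hD h0 h1 le_rfl
  have h3 : 0 < sin D ^ 2 - sin u ^ 2 := by nlinarith
  have hc := cos_pos_of_mem hD h0.le h1.le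
  unfold halfSideSlope
  have := hs.trans hs'
  positivity

/-- With `a = sin u ^ 2` and `C = sin D`, the square of the slope is
`C ^ 2 * (1 - a) / (a * (C ^ 2 - a))`; so the two slopes compare as the product `cos u * cos v`
compares with `cos D`. -/
lemma halfSideSlope_sq_sub {u v : ℝ} (hD : D < π / 2) (h0 : 0 < u) (h : u < v) (h1 : v < D) :
    ∃ k > 0, halfSideSlope D u ^ 2 - halfSideSlope D v ^ 2 =
      k * ((cos u * cos v) ^ 2 - cos D ^ 2) := by
  have hs := sin_pos_of_mem hD h0 (h.trans h1).le
  have hs1 := sin_lt_sin_of_mem hD h0 h h1.le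
  have hs2 := sin_lt_sin_of_mem hD (h0.trans h) h1 le_rfl
  have hv := hs.trans hs1
  have hsD := hv.trans hs2
  have hu3 : 0 < sin D ^ 2 - sin u ^ 2 := by nlinarith
  have hv3 : 0 < sin D ^ 2 - sin v ^ 2 := by nlinarith
  have huv : 0 < sin v ^ 2 - sin u ^ 2 := by nlinarith
  refine ⟨sin D ^ 2 * (sin v ^ 2 - sin u ^ 2) /
    (sin u ^ 2 * sin v ^ 2 * (sin D ^ 2 - sin u ^ 2) * (sin D ^ 2 - sin v ^ 2)), by positivity, ?_⟩
  unfold halfSideSlope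
  simp only [div_pow, mul_pow]
  rw [sq_sqrt hu3.le, sq_sqrt hv3.le, cos_sq' u, cos_sq' v, cos_sq' D]
  field_simp
  ring

lemma halfSideSlope_lt_iff {u v : ℝ} (hD : D < π / 2) (h0 : 0 < u) (h : u < v) (h1 : v < D) :
    halfSideSlope D u < halfSideSlope D v ↔ cos u * cos v < cos D := by
  obtain ⟨k, hk, he⟩ := halfSideSlope_sq_sub hD h0 h h1
  have p1 := halfSideSlope_pos hD h0 (h.trans h1)
  have p2 := halfSideSlope_pos hD (h0.trans h) h1
  have c1 := cos_pos_of_mem hD h0.le (h.trans h1).le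
  have c2 := cos_pos_of_mem hD (h0.trans h).le h1.le
  have c3 := cos_pos_of_mem hD (h0.trans (h.trans h1)).le le_rfl
  rw [← sq_lt_sq₀ p1.le p2.le, ← sq_lt_sq₀ (by positivity) c3.le, ← sub_neg, he,
    ← sub_neg (a := (cos u * cos v) ^ 2)]
  exact ⟨fun h => (pos_iff_neg_of_mul_neg h).1 hk, fun h => mul_neg_of_pos_of_neg hk h⟩

lemma lt_halfSideSlope_iff {u v : ℝ} (hD : D < π / 2) (h0 : 0 < u) (h : u < v) (h1 : v < D) :
    halfSideSlope D v < halfSideSlope D u ↔ cos D < cos u * cos v := by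
  obtain ⟨k, hk, he⟩ := halfSideSlope_sq_sub hD h0 h h1
  have p1 := halfSideSlope_pos hD h0 (h.trans h1)
  have p2 := halfSideSlope_pos hD (h0.trans h) h1
  have c1 := cos_pos_of_mem hD h0.le (h.trans h1).le
  have c2 := cos_pos_of_mem hD (h0.trans h).le h1.le
  have c3 := cos_pos_of_mem hD (h0.trans (h.trans h1)).le le_rfl
  rw [← sq_lt_sq₀ p2.le p1.le, ← sq_lt_sq₀ c3.le (by positivity), ← sub_pos, he,
    ← sub_pos (b := cos D ^ 2), mul_pos_iff_of_pos_left hk]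

lemma cos_mul_cos_sub_lt {K w u : ℝ} (hw : w < u) (hu : 2 * u ≤ K) (hK : K - 2 * w ≤ π) :
    cos w * cos (K - w) < cos u * cos (K - u) := by
  have h1 := two_mul_cos_mul_cos w (K - w)
  have h2 := two_mul_cos_mul_cos u (K - u)
  rw [← cos_neg (w - (K - w)), show w + (K - w) = K by ring,
    show -(w - (K - w)) = K - 2 * w by ring] at h1
  rw [← cos_neg (u - (K - u)), show u + (K - u) = K by ring,
    show -(u - (K - u)) = K - 2 * u by ring] at h2
  have := cos_lt_cos_of_nonneg_of_le_pi (x := K - 2 * u) (y := K - 2 * w) (by linarith) hK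
    (by linarith)
  linarith

/-- For a fixed sum `u + v = p + D`, the sum of the half sides is at least its value at one of the
two extreme splittings `(p, D)` and `((p + D) / 2, (p + D) / 2)`, strictly so for the first one:
along the splittings with `u ≤ v` the product `cos u * cos v` increases with `u`, so the sum first
increases and then decreases. -/
lemma halfSide_add_dichotomy {p u v : ℝ} (hD : D < π / 2) (hp : 0 < p) (hpu : p < u)
    (huv : u ≤ v) (hv : v < D) (hsum : u + v = p + D) :
    halfSide D p < halfSide D u + halfSide D v ∨
      2 * halfSide D ((p + D) / 2) ≤ halfSide D u + halfSide D v := by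
  set K := p + D with hK
  have hvK : v = K - u := by linarith
  have hcont : ContinuousOn (fun w => halfSide D w + halfSide D (K - w)) (Icc p (K / 2)) := by
    refine ContinuousOn.add ((continuousOn_halfSide hD).mono fun w hw => ?_)
      ((continuousOn_halfSide hD).comp (by fun_prop) fun w hw => ?_)
    · exact ⟨by linarith [hw.1], by linarith [hw.2]⟩
    · exact ⟨by linarith [hw.2], by linarith [hw.1]⟩
  have hder : ∀ w ∈ Ioo p (K / 2), HasDerivAt (fun w => halfSide D w + halfSide D (K - w))
      (halfSideSlope D (K - w) - halfSideSlope D w) w := by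
    intro w hw
    have h1 := hasDerivAt_halfSide hD (u := w) (by linarith [hw.1]) (by linarith [hw.2])
    have h2 := hasDerivAt_halfSide hD (u := K - w) (by linarith [hw.2]) (by linarith [hw.1])
    refine (h1.add (h2.comp w ((hasDerivAt_id w).const_sub K))).congr_deriv ?_
    ring
  have hKπ : ∀ w, p ≤ w → K - 2 * w ≤ π := fun w hw => by linarith [pi_pos]
  rcases lt_or_ge (cos u * cos v) (cos D) with hlt | hge
  · left
    have hmono : StrictMonoOn (fun w => halfSide D w + halfSide D (K - w)) (Icc p u) := by
      refine strictMonoOn_of_deriv_pos (convex_Icc _ _)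
        (hcont.mono (Icc_subset_Icc_right (by linarith))) fun w hw => ?_
      rw [interior_Icc] at hw
      rw [(hder w ⟨hw.1, by linarith [hw.2]⟩).deriv, sub_pos,
        halfSideSlope_lt_iff hD (by linarith [hw.1]) (by linarith [hw.2]) (by linarith [hw.1])]
      refine lt_trans ?_ hlt
      rw [hvK]
      exact cos_mul_cos_sub_lt hw.2 (by linarith) (hKπ w hw.1.le)
    have := hmono (left_mem_Icc.2 hpu.le) (right_mem_Icc.2 hpu.le) hpu
    simp only [← hvK] at this
    rwa [show K - p = D by rw [hK]; ring, halfSide_self hD (by linarith), add_zero] at this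
  · right
    have hanti : AntitoneOn (fun w => halfSide D w + halfSide D (K - w)) (Icc u (K / 2)) := by
      refine antitoneOn_of_deriv_nonpos (convex_Icc _ _)
        (hcont.mono (Icc_subset_Icc_left hpu.le)) ?_ fun w hw => ?_
      · rw [interior_Icc]
        exact fun w hw => (hder w ⟨hpu.trans hw.1, hw.2⟩).differentiableAt.differentiableWithinAt
      rw [interior_Icc] at hw
      rw [(hder w ⟨hpu.trans hw.1, hw.2⟩).deriv, sub_nonpos]
      refine ((lt_halfSideSlope_iff hD (by linarith [hw.1]) (by linarith [hw.2])
        (by linarith [hw.1])).2 ?_).le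
      refine lt_of_le_of_lt hge ?_
      rw [hvK]
      exact cos_mul_cos_sub_lt hw.1 (by linarith [hw.2]) (hKπ u hpu.le)
    have := hanti (left_mem_Icc.2 (by linarith)) (right_mem_Icc.2 (by linarith))
      (by linarith : u ≤ K / 2)
    simp only [← hvK] at this
    rw [show K - K / 2 = K / 2 by ring] at this
    linarith

/-- The function `2 * halfSide D ((u + D) / 2) - halfSide D u` increases from `-∞` on an initial
interval and then decreases to `0` at `D`, so it changes sign exactly once in `(0, D)`. -/
lemma exists_threshold (hD : D < π / 2) (hD0 : 0 < D) :
    ∃ T ∈ Ioo 0 D, 2 * halfSide D ((T + D) / 2) - halfSide D T = 0 ∧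
      (∀ u ∈ Ioo 0 T, 2 * halfSide D ((u + D) / 2) - halfSide D u < 0) ∧
      (∀ u ∈ Ioo T D, 0 < 2 * halfSide D ((u + D) / 2) - halfSide D u) := by
  set F : ℝ → ℝ := fun u => 2 * halfSide D ((u + D) / 2) - halfSide D u with hF
  have hcont : ContinuousOn F (Ioc 0 D) := by
    refine ContinuousOn.sub (continuousOn_const.mul ((continuousOn_halfSide hD).comp (by fun_prop)
      fun w hw => ?_)) (continuousOn_halfSide hD)
    exact ⟨by linarith [hw.1], by linarith [hw.2]⟩
  have hder : ∀ u ∈ Ioo 0 D, HasDerivAt F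
      (halfSideSlope D u - halfSideSlope D ((u + D) / 2)) u := by
    intro u hu
    have h1 := hasDerivAt_halfSide hD hu.1 hu.2
    have h2 := hasDerivAt_halfSide hD (u := (u + D) / 2) (by linarith [hu.1]) (by linarith [hu.2])
    refine (((h2.comp u (((hasDerivAt_id u).add_const D).div_const 2)).const_mul 2).sub
      h1).congr_deriv ?_
    ring
  have hanti : ∀ {u v : ℝ}, 0 ≤ u → u < v → v ≤ D →
      cos v * cos ((v + D) / 2) < cos u * cos ((u + D) / 2) := by
    intro u v hu huv hv
    have h1 := cos_lt_cos_of_nonneg_of_le_pi_div_two hu (by linarith : v ≤ π / 2) huv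
    have h2 := cos_lt_cos_of_nonneg_of_le_pi_div_two (x := (u + D) / 2) (y := (v + D) / 2)
      (by linarith) (by linarith) (by linarith)
    exact mul_lt_mul h1 h2.le (cos_pos_of_mem hD (by linarith) (by linarith))
      (cos_pos_of_mem hD hu (by linarith)).le
  -- `a` is the critical point of `F`
  obtain ⟨a, ha, haD⟩ : ∃ a ∈ Ioo 0 D, cos a * cos ((a + D) / 2) = cos D := by
    have hc : ContinuousOn (fun u => cos u * cos ((u + D) / 2)) (Icc 0 D) := by fun_prop
    refine intermediate_value_Ioo' hD0.le hc ⟨?_, ?_⟩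
    · have h1 := cos_pos_of_mem hD hD0.le le_rfl
      have h2 : cos D < 1 := by
        simpa using cos_lt_cos_of_nonneg_of_le_pi_div_two le_rfl hD.le hD0
      simp only [add_self_div_two]
      nlinarith
    · simp only [cos_zero, one_mul, zero_add]
      exact cos_lt_cos_of_nonneg_of_le_pi_div_two (by linarith) hD.le (by linarith)
  have hmonoF : StrictMonoOn F (Ioc 0 a) := by
    refine strictMonoOn_of_deriv_pos (convex_Ioc _ _)
      (hcont.mono (Ioc_subset_Ioc_right ha.2.le)) fun u hu => ?_
    rw [interior_Ioc] at hu
    rw [(hder u ⟨hu.1, hu.2.trans ha.2⟩).deriv, sub_pos,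
      lt_halfSideSlope_iff hD hu.1 (by linarith [hu.2, ha.2]) (by linarith [hu.2, ha.2]), ← haD]
    exact hanti hu.1.le hu.2 ha.2.le
  have hantiF : StrictAntiOn F (Icc a D) := by
    refine strictAntiOn_of_deriv_neg (convex_Icc _ _)
      (hcont.mono fun u hu => ⟨by linarith [hu.1, ha.1], hu.2⟩) fun u hu => ?_
    rw [interior_Icc] at hu
    rw [(hder u ⟨ha.1.trans hu.1, hu.2⟩).deriv, sub_neg,
      halfSideSlope_lt_iff hD (ha.1.trans hu.1) (by linarith [hu.2]) (by linarith [hu.2]), ← haD]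
    exact hanti ha.1.le hu.1 hu.2.le
  have hFD : F D = 0 := by
    simp only [hF, add_self_div_two, halfSide_self hD hD0]; ring
  have hpos : ∀ u ∈ Ico a D, 0 < F u := fun u hu => by
    rw [← hFD]
    exact hantiF ⟨hu.1, hu.2.le⟩ ⟨ha.2.le, le_rfl⟩ hu.2
  -- `F` is negative near `0`: for `b ≤ sin D / y` the half side `halfSide D b` exceeds `arcosh y`
  obtain ⟨b, hb, hFb⟩ : ∃ b ∈ Ioo 0 a, F b < 0 := by
    set y := cosh (2 * halfSide D (D / 2)) with hy
    have hy0 : 0 < y := cosh_pos _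
    have hsD := sin_pos_of_mem hD hD0 le_rfl
    refine ⟨min (a / 2) (sin D / y), ⟨lt_min (by linarith [ha.1]) (by positivity),
      (min_le_left _ _).trans_lt (by linarith [ha.1])⟩, ?_⟩
    set b := min (a / 2) (sin D / y) with hb
    have hb0 : 0 < b := lt_min (by linarith [ha.1]) (by positivity)
    have hba : b ≤ a / 2 := min_le_left _ _
    have hby : b ≤ sin D / y := min_le_right _ _
    have hsb := sin_pos_of_mem hD hb0 (by linarith [ha.1, ha.2])
    have hG : 0 ≤ halfSide D (D / 2) := by
      rw [← halfSide_self hD hD0]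
      exact halfSide_antitone hD (by linarith) (by linarith) le_rfl
    have h1 : 2 * halfSide D (D / 2) < halfSide D b := by
      rw [← arcosh_cosh (x := 2 * halfSide D (D / 2)) (by positivity)]
      unfold halfSide
      rw [arcosh_lt_arcosh (cosh_pos _) (by positivity)]
      change y < _
      rw [lt_div_iff₀ hsb]
      rw [le_div_iff₀ hy0] at hby
      have := sin_lt hb0
      nlinarith
    have h2 : halfSide D ((b + D) / 2) ≤ halfSide D (D / 2) :=
      halfSide_antitone hD (by linarith) (by linarith) (by linarith [ha.2])
    simp only [hF]
    linarith
  obtain ⟨T, hT, hFT⟩ : ∃ T ∈ Ioo b a, F T = 0 :=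
    intermediate_value_Ioo hb.2.le (hcont.mono fun u hu => ⟨by linarith [hu.1, hb.1],
      by linarith [hu.2, ha.2]⟩) ⟨hFb, hpos a ⟨le_rfl, ha.2⟩⟩
  have hT0 : 0 < T := hb.1.trans hT.1
  refine ⟨T, ⟨hT0, hT.2.trans ha.2⟩, hFT, fun u hu => ?_, fun u hu => ?_⟩
  · change F u < 0
    rw [← hFT]
    exact hmonoF ⟨hu.1, by linarith [hu.2, hT.2]⟩ ⟨hT0, hT.2.le⟩ hu.2
  · change 0 < F u
    rcases lt_or_ge u a with hua | hua
    · rw [← hFT]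
      exact hmonoF ⟨hT0, hT.2.le⟩ ⟨hT0.trans hu.1, hua.le⟩ hu.1
    · exact hpos u ⟨hua, hu.2⟩

end

/-! ### Comparison of perimeters -/

lemma g_eq_halfSide (n : ℕ) (x : ℝ) : g n x = halfSide (Real.pi / 2 - Real.pi / n) (x / 2) := by
  rw [g, halfSide, Real.sin_pi_div_two_sub]

lemma phi_eq_halfSide (n : ℕ) (x : ℝ) :
    phi n x = 2 * halfSide (Real.pi / 2 - Real.pi / n) ((x / 2 + (Real.pi / 2 - Real.pi / n)) / 2) -
      halfSide (Real.pi / 2 - Real.pi / n) (x / 2) := by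
  rw [phi, g_eq_halfSide, g_eq_halfSide, add_sub_assoc]

/-- Range of the interior angle, perimeter and area of a regular polygon. -/
lemma ConvexPolygon.IsRegularWithAngle.perim_area {n : ℕ} {P : ConvexPolygon n} {θ : ℝ}
    (hP : P.IsRegularWithAngle θ) :
    θ ∈ Set.Ioo 0 (((n : ℝ) - 2) * Real.pi / n) ∧ P.perim = 2 * n * g n θ ∧
      P.area = ENNReal.ofReal (((n : ℝ) - 2) * Real.pi - n * θ) := by
  obtain ⟨c, ρ, φ, hρ, h⟩ := P.exists_isCentered hP
  exact ⟨⟨(sin_half_angle hP h hρ).1, angle_lt hP h hρ⟩, perim_eq hP h hρ, area_eq hP h hρ⟩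

/-- By the Gauss–Bonnet formula, additivity of the areas is a linear relation of the angles. -/
lemma ConvexPolygon.add_angle_eq {n : ℕ} {P P₁ P₂ : ConvexPolygon n} {θ θ₁ θ₂ : ℝ}
    (hP : P.IsRegularWithAngle θ) (hP₁ : P₁.IsRegularWithAngle θ₁) (hP₂ : P₂.IsRegularWithAngle θ₂)
    (h : P₁.area + P₂.area = P.area) : θ₁ + θ₂ = θ + ((n : ℝ) - 2) * Real.pi / n := by
  have hn0 : (0 : ℝ) < n := by
    have := P.three_le
    exact_mod_cast (by omega : 0 < n)
  have key : ∀ {t : ℝ}, t < ((n : ℝ) - 2) * Real.pi / n → 0 ≤ ((n : ℝ) - 2) * Real.pi - n * t :=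
    fun {t} ht => by rw [lt_div_iff₀ hn0] at ht; linarith
  obtain ⟨h0, -, ha⟩ := hP.perim_area
  obtain ⟨h1, -, ha₁⟩ := hP₁.perim_area
  obtain ⟨h2, -, ha₂⟩ := hP₂.perim_area
  rw [ha, ha₁, ha₂, ← ENNReal.ofReal_add (key h1.2) (key h2.2),
    ENNReal.ofReal_eq_ofReal_iff (add_nonneg (key h1.2) (key h2.2)) (key h0.2)] at h
  field_simp
  linarith

/-- Two regular polygons of total area that of `P` have total perimeter larger than that of `P`, or
at least that of the two congruent ones. -/
lemma ConvexPolygon.perim_dichotomy {n : ℕ} {P P₁ P₂ : ConvexPolygon n} {θ : ℝ}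
    (hP : P.IsRegularWithAngle θ) (hP₁ : P₁.IsRegular) (hP₂ : P₂.IsRegular)
    (h : P₁.area + P₂.area = P.area) :
    P.perim < P₁.perim + P₂.perim ∨ P.perim + 2 * n * phi n θ ≤ P₁.perim + P₂.perim := by
  obtain ⟨θ₁, hP₁⟩ := hP₁
  obtain ⟨θ₂, hP₂⟩ := hP₂
  have hn := P.three_le
  have hn0 : (0 : ℝ) < n := by exact_mod_cast (by omega : 0 < n)
  wlog hle : θ₁ ≤ θ₂ generalizing P₁ P₂ θ₁ θ₂
  · rw [add_comm P₁.perim]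
    exact this (by rw [add_comm, h]) θ₂ hP₂ θ₁ hP₁ (not_le.1 hle).le
  have hsum := add_angle_eq hP hP₁ hP₂ h
  obtain ⟨h0, hp, -⟩ := hP.perim_area
  obtain ⟨h1, hp₁, -⟩ := hP₁.perim_area
  obtain ⟨h2, hp₂, -⟩ := hP₂.perim_area
  have hM : ((n : ℝ) - 2) * Real.pi / n = 2 * (Real.pi / 2 - Real.pi / n) := by field_simp
  rw [hM] at h0 h1 h2 hsum
  have hD := (pi_div_bounds hn).1
  rw [hp, hp₁, hp₂, phi_eq_halfSide, g_eq_halfSide, g_eq_halfSide, g_eq_halfSide]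
  rcases halfSide_add_dichotomy (D := Real.pi / 2 - Real.pi / n) (p := θ / 2) (u := θ₁ / 2)
    (v := θ₂ / 2) (by linarith) (by linarith [h0.1]) (by linarith [h2.2]) (by linarith)
    (by linarith [h2.2]) (by linarith) with h | h
  · left
    rw [← mul_add]
    gcongr
  · right
    rw [← mul_add, ← mul_add]
    exact mul_le_mul_of_nonneg_left (by linarith) (by positivity)

end HyperbolicPlane

end

open HyperbolicPlane in
theorem mainTheorem3 (n : ℕ) (hn : 3 ≤ n) :
    ∃ Θ : ℝ,
      (Θ ∈ Set.Ioo 0 (((n : ℝ) - 2) * Real.pi / n) ∧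
        HyperbolicPlane.phi n Θ = 0 ∧
        ∀ x ∈ Set.Ioo 0 (((n : ℝ) - 2) * Real.pi / n), HyperbolicPlane.phi n x = 0 → x = Θ) ∧
      ∀ (θ : ℝ) (P : HyperbolicPlane.ConvexPolygon n), P.IsRegularWithAngle θ →
        (Θ ≤ θ → ∀ P₁ P₂ : HyperbolicPlane.ConvexPolygon n, P₁.IsRegular → P₂.IsRegular →
          P₁.area + P₂.area = P.area → P.perim ≤ P₁.perim + P₂.perim) ∧
        (Θ < θ → ∀ P₁ P₂ : HyperbolicPlane.ConvexPolygon n, P₁.IsRegular → P₂.IsRegular →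
          P₁.area + P₂.area = P.area → P.perim < P₁.perim + P₂.perim) ∧
        (θ < Θ → ∃ Q₁ Q₂ : HyperbolicPlane.ConvexPolygon n, Q₁.IsRegular ∧ Q₂.IsRegular ∧
          Disjoint Q₁.region Q₂.region ∧
          Q₁.area + Q₂.area = P.area ∧ Q₁.perim + Q₂.perim < P.perim) := by
  have hn0 : (0 : ℝ) < n := by exact_mod_cast (by omega : 0 < n)
  obtain ⟨hp0, hp1⟩ := pi_div_bounds hn
  have hM : ((n : ℝ) - 2) * Real.pi / n = 2 * (Real.pi / 2 - Real.pi / n) := by field_simp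
  obtain ⟨T, hT, hT0, hTneg, hTpos⟩ := exists_threshold (D := Real.pi / 2 - Real.pi / n)
    (by linarith) (by linarith [Real.pi_pos])
  have hzero : phi n (2 * T) = 0 := by
    rw [phi_eq_halfSide, mul_div_cancel_left₀ T two_ne_zero, hT0]
  have hneg : ∀ x, 0 < x → x < 2 * T → phi n x < 0 := fun x h0 h1 => by
    rw [phi_eq_halfSide]
    exact hTneg _ ⟨by linarith, by linarith⟩
  have hpos : ∀ x, 2 * T < x → x < ((n : ℝ) - 2) * Real.pi / n → 0 < phi n x := fun x h0 h1 => by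
    rw [phi_eq_halfSide]
    exact hTpos _ ⟨by linarith, by linarith⟩
  refine ⟨2 * T, ⟨⟨by linarith [hT.1], by linarith [hT.2]⟩, hzero, fun x hx hx0 => ?_⟩,
    fun θ P hP => ⟨fun hle P₁ P₂ hP₁ hP₂ h => ?_, fun hlt P₁ P₂ hP₁ hP₂ h => ?_, fun hlt => ?_⟩⟩
  · rcases lt_trichotomy x (2 * T) with hlt | heq | hgt
    · exact absurd hx0 (hneg x hx.1 hlt).ne
    · exact heq
    · exact absurd hx0 (hpos x hgt hx.2).ne'
  · obtain ⟨h0, -, -⟩ := hP.perim_area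
    have hφ : 0 ≤ phi n θ := by
      rcases hle.eq_or_lt with rfl | hlt
      · exact hzero.ge
      · exact (hpos θ hlt h0.2).le
    rcases ConvexPolygon.perim_dichotomy hP hP₁ hP₂ h with h | h
    · exact h.le
    · have : 0 ≤ 2 * n * phi n θ := by positivity
      linarith
  · obtain ⟨h0, -, -⟩ := hP.perim_area
    have hφ := hpos θ hlt h0.2
    rcases ConvexPolygon.perim_dichotomy hP hP₁ hP₂ h with h | h
    · exact h
    · have : 0 < 2 * n * phi n θ := by positivity
      linarith
  · obtain ⟨h0, hperim, harea⟩ := hP.perim_area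
    have hφ := hneg θ h0.1 hlt
    have hθ' : θ / 2 + Real.pi / 2 - Real.pi / n ∈ Set.Ioo 0 (((n : ℝ) - 2) * Real.pi / n) :=
      ⟨by linarith [h0.1], by linarith [h0.2]⟩
    obtain ⟨ρ, hρ, hQ⟩ := exists_polygon_of_angle hn hθ'.1 hθ'.2
    obtain ⟨d, hd⟩ := exists_dist_gt UpperHalfPlane.I (2 * Real.arcosh √(1 + ρ ^ 2))
    obtain ⟨Q₁, hc₁, hQ₁⟩ := hQ UpperHalfPlane.I
    obtain ⟨Q₂, hc₂, hQ₂⟩ := hQ d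
    obtain ⟨-, hperim₁, harea₁⟩ := hQ₁.perim_area
    obtain ⟨-, hperim₂, harea₂⟩ := hQ₂.perim_area
    refine ⟨Q₁, Q₂, ⟨_, hQ₁⟩, ⟨_, hQ₂⟩, ConvexPolygon.disjoint_region hc₁ hc₂ hρ hd, ?_, ?_⟩
    · have e : (n : ℝ) * (Real.pi / n) = Real.pi := by field_simp
      have hnn : 0 ≤ ((n : ℝ) - 2) * Real.pi - n * (θ / 2 + Real.pi / 2 - Real.pi / n) := by
        have := hθ'.2
        rw [lt_div_iff₀ hn0] at this
        linarith
      rw [harea₁, harea₂, harea, ← ENNReal.ofReal_add hnn hnn]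
      congr 1
      linear_combination 2 * e
    · rw [hperim₁, hperim₂, hperim]
      unfold phi at hφ
      nlinarith
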